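/- **Setting.** Work over $\mathbf{C}$. A toric variety with character group $M$ (a finitely generated free abelian group) is a normal integral separated scheme of finite type containing the torus $\operatorname{Spec}\mathbf{C}[M]$ as an open subscheme, such that multiplication of the torus extends to an action on the whole scheme. For $i=1,2$ let $Y^{(i)}$ be a toric variety with character group $M^{(i)}$ and torus $T_{Y^{(i)}}$, let $\mathcal{V}^{(i)}=\mathcal{L}^{(i)}_1\oplus\dots\oplus\mathcal{L}^{(i)}_r$ be a direct sum of line bundles on $Y^{(i)}$ (for instance nef ones; no positivity is needed), let $g^{(i)}=(\ell^{(i)}_1,\dots,\ell^{(i)}_r)$ be a global section of $\mathcal{V}^{(i)}$, and let $Z^{(i)}\subseteq Y^{(i)}$ be its scheme-theoretic zero locus. Let $X^{(i)}=\operatorname{Spec}_{Y^{(i)}}\operatorname{Sym}^\bullet\mathcal{V}^{(i)}$ be the total space of the dual bundle, with the structure of a toric variety given by trivializations $e^{(i)}_k$ of $\mathcal{L}^{(i)}_k$ over $T_{Y^{(i)}}$: its character group is $\overline M^{(i)}=M^{(i)}\oplus\mathbf{Z}^r$, where the $k$-th basis vector of $\mathbf{Z}^r$ is $e_k^{(i)}$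 regarded as a function. Write $W^{(i)}_k$ for $\ell^{(i)}_k$ regarded as a function on $X^{(i)}$, put $W^{(i)}=\sum_kW^{(i)}_k$, and let $\Lambda^{(i)}_k\subset\overline M^{(i)}$ be the set of characters with non-zero coefficient in the expansion of $W^{(i)}_k$ on the torus of $X^{(i)}$. Assume that the affinizations of $X^{(1)}$ and $X^{(2)}$ are isomorphic as toric varieties, with the same superpotential: a $\mathbf{C}$-algebra isomorphism $\Phi:\Gamma(X^{(1)},\mathcal{O})\cong\Gamma(X^{(2)},\mathcal{O})$ is given which identifies the monoids of global characters and satisfies $\Phi(W^{(1)})=W^{(2)}$. Using $\Phi$, identify global characters on $X^{(1)}$ and $X^{(2)}$. Assume, after relabelling the $\mathcal{L}^{(2)}_k$ by some permutation, 1. $\Lambda^{(1)}_k\cap\Lambda^{(2)}_k\neq\varnothing$ for all $k$; 2. for $i=1,2$, the quotients $\chi/\chi'$ with $\chi,\chi'\in\Lambda^{(i)}_k$ for some $k$ generate the group of all characters of $T_{Y^{(i)}}$. Let $c_\chi$ be the coefficient of $\chi$ in $W=W^{(1)}=W^{(2)}$, let $(W)$ be the $r\times r$ matrix with entries $W_{ab}=\sum_{\chi\in\Lambda^{(1)}_a\cap\Lambda^{(2)}_b}c_\chi\chi$,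 let $D$ be the directed graph on $\{1,\dots,r\}$ with an arrow from $a$ to $b$ whenever $\Lambda^{(1)}_a\cap\Lambda^{(2)}_b\ne\varnothing$, and let $\beta$ be the number of its connected components (ignoring orientation). **Theorem ($\Omega$ isomorphism).** There is a unique isomorphism $\overline M^{(1)}\cong\overline M^{(2)}$ whose induced identification of the tori of $X^{(1)}$ and $X^{(2)}$ with a single torus $T$ is compatible, via $\Phi$, with the maps to the affinizations. Let $S\subseteq T$ be the closed subscheme of $T$ lying over both $Z^{(1)}$ and $Z^{(2)}$, and let $R^{(1)}\cap R^{(2)}$ be the set of points of $S$ at which $(W)$ has rank $r-\beta$. Then $R^{(1)}\cap R^{(2)}$ is open in $S$, its image $\Omega^{(i)}$ in $Z^{(i)}$ is open for $i=1,2$, and with the induced open subscheme structures: * the torus $\mathbf{G}_m^\beta$, acting on $T$ by rescaling the fibre coordinates of $X^{(1)}$ with indices in the $j$-th component of $D$ by the $j$-th factor and fixing the coordinates of $Y^{(1)}$, preserves $R^{(1)}\cap R^{(2)}$; * for $i=1,2$ the projection $\pi_i:R^{(1)}\cap R^{(2)}\to\Omega^{(i)}$ is a trivial $\mathbf{G}_m^\beta$-torsor,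 that is, $R^{(1)}\cap R^{(2)}\cong\mathbf{G}_m^\beta\times\Omega^{(i)}$ equivariantly over $\Omega^{(i)}$; in particular the action is free and $\Omega^{(i)}$ is its quotient; * there is an isomorphism $\varepsilon:\Omega^{(1)}\cong\Omega^{(2)}$ of schemes over $\mathbf{C}$ with $\varepsilon\circ\pi_1=\pi_2$. -/

import Mathlib

open CategoryTheory MonoidalCategory CartesianMonoidalCategory MonObj AlgebraicGeometry

noncomputable section

namespace ToricLG

/-! ### Tori and toric varieties over the complex numbers -/

/-- The base scheme `Spec ℂ`. -/
abbrev SpecC : Scheme.{0} := Spec (.of ℂ)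

/-- The algebraic torus `Spec ℂ[M]` with character group `M`, as a scheme over `ℂ`. Its group
scheme structure is the one given by the Hopf algebra `ℂ[M]`, in which characters are
group-like. -/
abbrev Torus (M : Type) [AddCommGroup M] : Over SpecC :=
  (Spec (.of (AddMonoidAlgebra ℂ M))).asOver SpecC

/-- The homomorphism of tori `Spec ℂ[N] ⟶ Spec ℂ[M]` dual to a map of character groups. -/
def torusHom {M N : Type} [AddCommGroup M] [AddCommGroup N] (f : M →+ N) : Torus N ⟶ Torus M :=
  Over.homMk (Spec.map (CommRingCat.ofHom (AddMonoidAlgebra.mapDomainAlgHom ℂ ℂ f).toRingHom))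
    (by
      change Spec.map _ ≫ Spec.map _ = Spec.map _
      rw [← Spec.map_comp, ← CommRingCat.ofHom_comp]
      congr 2
      ext z
      simp)

/-- The character `χ^m`, as an element of `ℂ[M]`. -/
abbrev chi {M : Type} (m : M) : AddMonoidAlgebra ℂ M := AddMonoidAlgebra.single m 1

/-- A toric variety with character group `M`: a normal integral separated scheme of finite type
over `ℂ`, containing the torus `Spec ℂ[M]` as an open (automatically dense) subscheme, such that
the multiplication of the torus extends to an action on the whole scheme. -/
structure ToricVariety (M : Type) [AddCommGroup M] where
  /-- the underlying variety -/
  V : Over SpecC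
  integral : IsIntegral V.left
  separated : IsSeparated V.hom
  locallyOfFiniteType : LocallyOfFiniteType V.hom
  quasiCompact : QuasiCompact V.hom
  normal : ∀ x : V.left, IsIntegrallyClosed (V.left.presheaf.stalk x)
  /-- the inclusion of the torus -/
  emb : Torus M ⟶ V
  isOpenImmersion_emb : IsOpenImmersion emb.left
  /-- the action of the torus -/
  act : ModObj (Torus M) V
  act_emb : (Torus M ◁ emb) ≫ γ[Torus M, V] = μ[Torus M] ≫ emb

attribute [instance] ToricVariety.integral ToricVariety.isOpenImmersion_emb ToricVariety.act

/-- The torus of a toric variety, as an open subset of it. -/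
def ToricVariety.torusOpen {M : Type} [AddCommGroup M] (Y : ToricVariety M) : Y.V.left.Opens :=
  Y.emb.left.opensRange

/-- Restriction of global functions on a toric variety to its torus: every such function is
expanded in characters. -/
def ToricVariety.expand {M : Type} [AddCommGroup M] (Y : ToricVariety M) :
    Γ(Y.V.left, ⊤) →+* AddMonoidAlgebra ℂ M :=
  ((Scheme.ΓSpecIso (.of (AddMonoidAlgebra ℂ M))).hom.hom).comp Y.emb.left.appTop.hom

/-- A global function on a toric variety is a character if it restricts to one on the torus. -/
def ToricVariety.IsCharacter {M : Type} [AddCommGroup M] (Y : ToricVariety M)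
    (w : Γ(Y.V.left, ⊤)) : Prop :=
  ∃ m : M, Y.expand w = chi m

/-- The constant global functions on a scheme over `ℂ`. -/
def constants (X : Over SpecC) : ℂ →+* Γ(X.left, ⊤) :=
  X.hom.appTop.hom.comp (Scheme.ΓSpecIso (.of ℂ)).inv.hom

/-! ### Line bundles and total spaces -/

/-- The section `s` of the sheaf of modules `L` over `U` is a free generator of `L` over `U`
(a trivialization). -/
def IsGenerator {Y : Scheme.{0}} (L : Y.Modules) {U : Y.Opens} (s : Γ(L, U)) : Prop :=
  ∀ (V : Y.Opens) (h : V ≤ U),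
    Function.Bijective fun f : Γ(Y, V) => f • (L.presheaf.map (homOfLE h).op s : Γ(L, V))

/-- A line bundle: a sheaf of modules that is locally free of rank one. -/
def IsLineBundle {Y : Scheme.{0}} (L : Y.Modules) : Prop :=
  ∀ y : Y, ∃ U : Y.Opens, y ∈ U ∧ ∃ s : Γ(L, U), IsGenerator L s

/-- An `𝒪_Y`-linear map `L ⟶ f_* 𝒪_S`: it turns sections of `L` over `U` into functions on the
preimage of `U`. -/
structure FunctionMap {Y S : Scheme.{0}} (L : Y.Modules) (f : S ⟶ Y) where
  map (U : Y.Opens) : Γ(L, U) →+ Γ(S, f ⁻¹ᵁ U)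
  map_smul (U : Y.Opens) (a : Γ(Y, U)) (s : Γ(L, U)) : map U (a • s) = f.app U a * map U s
  map_restrict (U V : Y.Opens) (h : V ≤ U) (s : Γ(L, U)) :
    map V (L.presheaf.map (homOfLE h).op s) =
      S.presheaf.map (homOfLE (f.preimage_mono h)).op (map U s)

/-- `p : X ⟶ Y`, with the tautological maps `ξ k : L k ⟶ p_* 𝒪_X` which regard sections of
`L k` as functions, is the total space `Spec_Y Sym (⨁ L k)` of the dual of the bundle `⨁ L k`.
This is the universal property of the relative spectrum of the symmetric algebra: for
`f : S ⟶ Y`, lifts of `f` to `X` correspond to `𝒪_Y`-linear maps from `⨁ L k` to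
`f_* 𝒪_S`. -/
def IsDualTotalSpace {Y X : Scheme.{0}} {r : ℕ} (L : Fin r → Y.Modules) (p : X ⟶ Y)
    (ξ : ∀ k, FunctionMap (L k) p) : Prop :=
  ∀ (S : Scheme.{0}) (f : S ⟶ Y) (h : ∀ k, FunctionMap (L k) f),
    ∃! g : S ⟶ X, ∃ hg : g ≫ p = f, ∀ (k : Fin r) (U : Y.Opens) (s : Γ(L k, U)),
      (h k).map U s = g.appLE (p ⁻¹ᵁ U) (f ⁻¹ᵁ U) (by rw [← hg]; rfl) ((ξ k).map U s)

/-- The ideal sheaf of the vanishing scheme of the section `(ℓ k)_k` of `⨁ L k`: the smallest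
ideal sheaf which contains, for every affine open `U` and every trivialization `s` of some `L k`
on `U`, the coordinate `f` of `ℓ k = f • s`. -/
def vanishingIdeal {Y : Scheme.{0}} {r : ℕ} (L : Fin r → Y.Modules) (ℓ : ∀ k, Γ(L k, ⊤)) :
    Y.IdealSheafData :=
  sInf {J | ∀ (k : Fin r) (U : Y.affineOpens) (s : Γ(L k, U.1)), IsGenerator (L k) s →
    ∀ f : Γ(Y, U.1), (L k).presheaf.map (homOfLE le_top).op (ℓ k) = f • s → f ∈ J.ideal U}

/-! ### Toric complete intersections -/

/-- The data of a toric complete intersection: a toric variety `Y` with character group `M`, a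
completely split bundle `⨁ L k` of rank `r` on `Y`, a section `(ℓ k)_k` of it, and the total
space `X` of the dual bundle with its toric structure. The latter is given by trivializations
`e k` of the `L k` over the torus of `Y`; the character group of `X` is `M ⊕ ℤ^r`, where
`M` consists of the characters pulled back from `Y` and the `k`-th basis vector of `ℤ^r` is
`e k`, regarded as a function on `X`. -/
structure ToricCI (M : Type) [AddCommGroup M] (r : ℕ) where
  Y : ToricVariety M
  L : Fin r → Y.V.left.Modules
  isLineBundle : ∀ k, IsLineBundle (L k)
  ℓ : ∀ k, Γ(L k, ⊤)
  X : ToricVariety (M × (Fin r → ℤ))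
  p : X.V ⟶ Y.V
  ξ : ∀ k, FunctionMap (L k) p.left
  isDualTotalSpace : IsDualTotalSpace L p.left ξ
  e : ∀ k, Γ(L k, Y.torusOpen)
  e_generator : ∀ k, IsGenerator (L k) (e k)
  emb_p : X.emb ≫ p = torusHom (AddMonoidHom.inl M (Fin r → ℤ)) ≫ Y.emb
  preimage_torus : (⊤ : (Torus (M × (Fin r → ℤ))).left.Opens) ≤
    X.emb.left ⁻¹ᵁ (p.left ⁻¹ᵁ Y.torusOpen)
  e_character : ∀ k, X.emb.left.appLE _ ⊤ preimage_torus ((ξ k).map Y.torusOpen (e k)) =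
    (Scheme.ΓSpecIso (.of (AddMonoidAlgebra ℂ (M × (Fin r → ℤ))))).inv
      (chi (0, Pi.single k 1))

namespace ToricCI

variable {M M₁ M₂ : Type} [AddCommGroup M] [AddCommGroup M₁] [AddCommGroup M₂] {r : ℕ}

/-- The character group of the torus of the total space. -/
abbrev CharX (M : Type) (r : ℕ) : Type := M × (Fin r → ℤ)

/-- The ideal sheaf of the complete intersection `Z` in `Y`. -/
def idealZ (A : ToricCI M r) : A.Y.V.left.IdealSheafData := vanishingIdeal A.L A.ℓ

/-- The section `ℓ k` regarded as a function on the total space. -/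
def Wpart (A : ToricCI M r) (k : Fin r) : Γ(A.X.V.left, ⊤) := (A.ξ k).map ⊤ (A.ℓ k)

/-- The superpotential: the section `(ℓ k)_k` regarded as a function on the total space. -/
def W (A : ToricCI M r) : Γ(A.X.V.left, ⊤) := ∑ k, A.Wpart k

/-- The set of characters which appear with non-zero coefficient in the expansion of the `k`-th
part of the superpotential. -/
def Lam (A : ToricCI M r) (k : Fin r) : Finset (CharX M r) :=
  (A.X.expand (A.Wpart k)).coeff.support

/-- The quotients `χ / χ'` of characters in the same group `Lam k` generate all
characters of the torus of `Y`. -/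
def QuotientsGenerate (A : ToricCI M r) : Prop :=
  AddSubgroup.closure {m : M | ∃ k, ∃ χ ∈ A.Lam k, ∃ χ' ∈ A.Lam k, χ - χ' = (m, 0)} = ⊤

/-- An isomorphism of the affinizations `Spec Γ(X, 𝒪)` of the two total spaces as toric
varieties, such that the superpotentials agree: an isomorphism of the `ℂ`-algebras of global
functions which identifies the monoids of global characters and the superpotentials. -/
structure AffinizationIso (A : ToricCI M₁ r) (B : ToricCI M₂ r) where
  iso : Γ(A.X.V.left, ⊤) ≃+* Γ(B.X.V.left, ⊤)
  iso_constants : ∀ c : ℂ, iso (constants A.X.V c) = constants B.X.V c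
  iso_character : ∀ w, B.X.IsCharacter (iso w) ↔ A.X.IsCharacter w
  iso_W : iso A.W = B.W

section Pair

variable {A : ToricCI M₁ r} {B : ToricCI M₂ r} (Φ : AffinizationIso A B)

open scoped Classical in
/-- The intersection of the `a`-th group of characters of `A` and the `b`-th group of
characters of `B`, under the identification of global characters given by `Φ`. -/
def commonLam (a b : Fin r) : Finset (CharX M₁ r) :=
  (A.Lam a).filter fun χ => ∃ w, A.X.expand w = chi χ ∧ ∃ χ' ∈ B.Lam b, B.X.expand (Φ.iso w) = chi χ'

/-- The matrix `(W)` on the torus `T`: its `(a, b)` entry is the sum of the terms `c_χ χ` of the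
superpotential with `χ` in the `a`-th group of `A` and in the `b`-th group of `B`, where the
line bundles of `B` have been relabelled by `σ`. -/
def matrixW (σ : Equiv.Perm (Fin r)) :
    Matrix (Fin r) (Fin r) (AddMonoidAlgebra ℂ (CharX M₁ r)) :=
  Matrix.of fun a b => ∑ χ ∈ commonLam Φ a (σ b),
    AddMonoidAlgebra.single χ ((A.X.expand A.W).coeff χ)

/-- The graph `D` with an edge joining `a` and `b` if the `(a, b)` or the `(b, a)` entry of `(W)`
is non-zero. Loops and orientations of arrows do not affect the connected components. -/
def graphD (σ : Equiv.Perm (Fin r)) : SimpleGraph (Fin r) :=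
  SimpleGraph.fromRel fun a b => (commonLam Φ a (σ b)).Nonempty

/-- The set of connected components of `D`; its cardinality is `β`. -/
abbrev Blocks (σ : Equiv.Perm (Fin r)) : Type := (graphD Φ σ).ConnectedComponent

/-- The torus `𝔾_m^β`, with one factor for each connected component of `D`. -/
abbrev blockTorus (σ : Equiv.Perm (Fin r)) : Over SpecC := Torus (Blocks Φ σ → ℤ)

/-- An identification `θ` of the character groups of the tori of the total spaces is
compatible with `Φ`: the resulting identification of the tori commutes with the maps from them
to the affinizations. -/
def Compatible (θ : CharX M₁ r ≃+ CharX M₂ r) : Prop :=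
  ∀ w, B.X.expand (Φ.iso w) =
    AddMonoidAlgebra.mapDomainRingHom ℂ (θ : CharX M₁ r →+ CharX M₂ r) (A.X.expand w)

open scoped Classical in
/-- The cocharacters `𝔾_m^β ⟶ T` which rescale the fibre coordinates of `X` belonging to a
connected component of `D` by the corresponding factor and fix the coordinates of `Y`, as a map
of character groups. -/
def blockWeight (σ : Equiv.Perm (Fin r)) : CharX M₁ r →+ (Blocks Φ σ → ℤ) where
  toFun χ := ∑ a, Pi.single ((graphD Φ σ).connectedComponentMk a) (χ.2 a)
  map_zero' := by simp
  map_add' χ χ' := by simp [Pi.single_add, Finset.sum_add_distrib]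

variable (A) in
/-- The projection from the torus `T` of the first total space to `Y⁽¹⁾`. -/
def proj₁ : Torus (CharX M₁ r) ⟶ A.Y.V := A.X.emb ≫ A.p

variable (B) in
/-- The projection to `Y⁽²⁾` from the same torus `T`, which is identified with the torus of the
second total space through `θ`. -/
def proj₂ (θ : CharX M₁ r ≃+ CharX M₂ r) : Torus (CharX M₁ r) ⟶ B.Y.V :=
  torusHom (θ.symm : CharX M₂ r →+ CharX M₁ r) ≫ B.X.emb ≫ B.p

variable (A B) in
/-- The ideal sheaf of `S⁽¹⁾ ∩ S⁽²⁾`: the closed subscheme of `T` that lies over both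
`Z⁽¹⁾` and `Z⁽²⁾`. -/
def idealS (θ : CharX M₁ r ≃+ CharX M₂ r) : (Torus (CharX M₁ r)).left.IdealSheafData :=
  A.idealZ.comap (proj₁ A).left ⊔ B.idealZ.comap (proj₂ B θ).left

/-- The rank of the matrix `(W)` at a point of `T`, over the residue field of the point. -/
def rankW (σ : Equiv.Perm (Fin r)) (t : PrimeSpectrum (AddMonoidAlgebra ℂ (CharX M₁ r))) : ℕ :=
  ((matrixW Φ σ).map (algebraMap _ t.asIdeal.ResidueField)).rank

end Pair

end ToricCI

/-! ### Subschemes and torsors -/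

/-- An open subscheme `U` of the closed subscheme defined by an ideal sheaf `I` of `X`, as a
scheme over `ℂ`. -/
abbrev subObj {X : Over SpecC} (I : X.left.IdealSheafData) (U : I.subscheme.Opens) :
    Over SpecC :=
  Over.mk ((U.ι ≫ I.subschemeι) ≫ X.hom)

/-- The inclusion of an open subscheme of a closed subscheme. -/
def subIncl {X : Over SpecC} (I : X.left.IdealSheafData) (U : I.subscheme.Opens) :
    subObj I U ⟶ X :=
  Over.homMk (U.ι ≫ I.subschemeι)

/-- The action of the group scheme `G` on `R` makes `π : R ⟶ B` a trivial `G`-torsor: there is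
an isomorphism `G × B ≅ R` over `B`, equivariant for the action of `G` by multiplication on
the first factor. In particular the action is free and `π` is the quotient by it. -/
def IsTrivialTorsor (G : Over SpecC) [MonObj G] {R B : Over SpecC} [ModObj G R] (π : R ⟶ B) :
    Prop :=
  ∃ ψ : G ⊗ B ≅ R, ψ.hom ≫ π = snd G B ∧
    (G ◁ ψ.hom) ≫ γ[G, R] = (α_ G G B).inv ≫ (μ[G] ▷ B) ≫ ψ.hom

end ToricLG

end

open ToricLG ToricLG.ToricCI

/-! Each point of a torus is a family of invertible functions, so everything can be checked on
functors of points. Write `(W)_{ab} = u_a F_{ab}`, with `u_a` the fibre coordinates of `X⁽¹⁾` and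
`F_{ab}` functions on the torus of `Y⁽¹⁾`. Every character of `W` lies in exactly one `Λ⁽¹⁾_a` and
exactly one `Λ⁽²⁾_b`, so the row sums of `(W)` are the `W⁽¹⁾_a` and the column sums are the
`W⁽²⁾_b`. A point of `T` therefore lies over `Z⁽¹⁾` iff the row sums vanish, and over `Z⁽²⁾` iff the
column sums vanish; these are the equations of `S` (`Compatible.idealS_le_ker_iff`).

The matrix is block diagonal along the components of `D`. On `S` the indicator vector of each block
lies in its kernel, so the rank is at most `r - β`. Choose a root in each block and replace the root
columns by unit vectors: the rank is `r - β` iff the determinant of the new matrix is non-zero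
(`rank_add_card_eq_iff`). Up to a unit this determinant is a function `d` pulled back from the torus
of `Y⁽¹⁾` (`associated_det_rootedMatrix`).

Now fix a point of `Z⁽¹⁾` with `d` invertible. The points of `S` above it are the vectors `u` with
invertible entries and `∑ a, u_a F_{ab} = 0`. The cofactors give a left kernel vector `y` with value
`d` at each root, and it is unique up to one scalar per block. So `u_a = t_{c(a)} y_a / d` with `t ∈
𝔾_m^β` arbitrary, and solutions exist exactly where all `y_a` are invertible. This makes the image
of the rank locus the open set `d ∏ y_a ≠ 0` of `Z⁽¹⁾`, gives the section `t = 1`, and trivializes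
the torsor (`IsRankLocus.exists_isTrivialTorsor`).

The argument is symmetric under transposition, once the same action of `𝔾_m^β` is seen to rescale
the fibre coordinates of `X⁽²⁾` by blocks and to fix those of `Y⁽²⁾`. The latter holds because
quotients of characters in one `Λ⁽²⁾_b` have weight zero and generate
(`Compatible.blockWeight_symm_inl`). Both projections are then quotients of one scheme by one
action, whence `ε`.

The identification of the tori exists because torus invariance splits global functions into global
characters, and these generate both character groups. -/

noncomputable section

namespace ToricLG

open scoped TensorProduct

/-! ### Morphisms to an affine scheme -/

section Affine

variable {X X' : Scheme.{0}} {R S : CommRingCat.{0}}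

/-- The pullback of functions along a morphism to an affine scheme. -/
def pullSpec (f : X ⟶ Spec R) : R ⟶ Γ(X, ⊤) := (Scheme.ΓSpecIso R).inv ≫ f.appTop

lemma pullSpec_comp (g : X' ⟶ X) (f : X ⟶ Spec R) :
    pullSpec (g ≫ f) = pullSpec f ≫ g.appTop := by
  simp [pullSpec]

lemma pullSpec_comp_map (f : X ⟶ Spec S) (φ : R ⟶ S) :
    pullSpec (f ≫ Spec.map φ) = φ ≫ pullSpec f := by
  simp [pullSpec, Scheme.ΓSpecIso_inv_naturality_assoc]

lemma pullSpec_injective {f g : X ⟶ Spec R} (h : pullSpec f = pullSpec g) : f = g := by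
  apply ext_of_isAffine
  simpa [pullSpec] using h

/-- The morphism to an affine scheme given by a ring homomorphism. -/
def ofPullSpec (φ : R ⟶ Γ(X, ⊤)) : X ⟶ Spec R := X.toSpecΓ ≫ Spec.map φ

@[simp]
lemma pullSpec_ofPullSpec (φ : R ⟶ Γ(X, ⊤)) : pullSpec (ofPullSpec φ) = φ := by
  rw [ofPullSpec, pullSpec_comp_map, pullSpec, Scheme.toSpecΓ_appTop]
  simp

lemma pullSpec_id : pullSpec (𝟙 (Spec R)) = (Scheme.ΓSpecIso R).inv := by
  simp [pullSpec]

lemma mem_basicOpen_pullSpec (f : X ⟶ Spec R) (r : R) (x : X) :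
    x ∈ X.basicOpen (pullSpec f r) ↔ r ∉ (f x).asIdeal := by
  have h1 : X.basicOpen (pullSpec f r) =
      f ⁻¹ᵁ ((Spec R).basicOpen ((Scheme.ΓSpecIso R).inv r)) := by
    rw [Scheme.preimage_basicOpen]; rfl
  rw [h1, basicOpen_eq_of_affine']
  simp only [Iso.inv_hom_id_apply]
  rfl

lemma notMem_asIdeal_of_isUnit (f : X ⟶ Spec R) {r : R} (h : IsUnit (pullSpec f r)) (x : X) :
    r ∉ (f x).asIdeal := by
  rw [← mem_basicOpen_pullSpec, Scheme.basicOpen_of_isUnit _ h]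
  trivial

lemma mem_asIdeal_of_eq_zero (f : X ⟶ Spec R) {r : R} (h : pullSpec f r = 0) (x : X) :
    r ∈ (f x).asIdeal := by
  by_contra hr
  rw [← mem_basicOpen_pullSpec, h, Scheme.basicOpen_zero] at hr
  exact hr

lemma isUnit_of_notMem_asIdeal (f : X ⟶ Spec R) {r : R} (h : ∀ x, r ∉ (f x).asIdeal) :
    IsUnit (pullSpec f r) := by
  have h1 : X.basicOpen (pullSpec f r) = ⊤ :=
    top_le_iff.mp fun x _ => (mem_basicOpen_pullSpec f r x).mpr (h x)
  refine RingedSpace.isUnit_of_isUnit_germ X.toRingedSpace ⊤ (pullSpec f r) fun x hx => ?_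
  exact (Scheme.mem_basicOpen X (pullSpec f r) x hx).mp (by rw [h1]; exact hx)

end Affine

/-! ### The functor of points of a torus -/

section Torus

variable {M N : Type} [AddCommGroup M] [AddCommGroup N] {X X' : Over SpecC}

/-- The pullback of functions along a morphism to a torus. -/
def pullT (f : X ⟶ Torus M) : AddMonoidAlgebra ℂ M →+* Γ(X.left, ⊤) :=
  (pullSpec (R := .of (AddMonoidAlgebra ℂ M)) f.left).hom

lemma pullT_comp (g : X' ⟶ X) (f : X ⟶ Torus M) :
    pullT (g ≫ f) = g.left.appTop.hom.comp (pullT f) :=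
  congr(($(pullSpec_comp (R := .of (AddMonoidAlgebra ℂ M)) g.left f.left)).hom)

lemma pullT_comp_apply (g : X' ⟶ X) (f : X ⟶ Torus M) (x : AddMonoidAlgebra ℂ M) :
    pullT (g ≫ f) x = g.left.appTop (pullT f x) := by
  rw [pullT_comp]; rfl

lemma pullT_torusHom (f : X ⟶ Torus N) (φ : M →+ N) :
    pullT (f ≫ torusHom φ) = (pullT f).comp (AddMonoidAlgebra.mapDomainRingHom ℂ φ) :=
  congr(($(pullSpec_comp_map (R := .of (AddMonoidAlgebra ℂ M)) (S := .of (AddMonoidAlgebra ℂ N))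
    f.left (CommRingCat.ofHom (AddMonoidAlgebra.mapDomainAlgHom ℂ ℂ φ).toRingHom))).hom)

lemma pullT_torusHom_single (f : X ⟶ Torus N) (φ : M →+ N) (m : M) (c : ℂ) :
    pullT (f ≫ torusHom φ) (.single m c) = pullT f (.single (φ m) c) := by
  rw [pullT_torusHom]
  simp

lemma constants_eq_pullSpec (X : Over SpecC) : constants X = (pullSpec X.hom).hom := rfl

lemma pullT_algebraMap (f : X ⟶ Torus M) (c : ℂ) :
    pullT f (algebraMap ℂ _ c) = constants X c := by
  have h : X.hom = f.left ≫ Spec.map (CommRingCat.ofHom (algebraMap ℂ (AddMonoidAlgebra ℂ M))) :=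
    (Over.w f).symm
  rw [constants_eq_pullSpec, h]
  have h2 := pullSpec_comp_map (R := .of ℂ) (S := .of (AddMonoidAlgebra ℂ M))
    f.left (CommRingCat.ofHom (algebraMap ℂ (AddMonoidAlgebra ℂ M)))
  exact (congr($h2 c)).symm

lemma pullT_injective {f g : X ⟶ Torus M} (h : pullT f = pullT g) : f = g := by
  ext1
  exact pullSpec_injective (R := .of (AddMonoidAlgebra ℂ M)) (CommRingCat.hom_ext h)

lemma exists_pullT_eq (φ : AddMonoidAlgebra ℂ M →+* Γ(X.left, ⊤))
    (h : ∀ c, φ (algebraMap ℂ _ c) = constants X c) : ∃ f : X ⟶ Torus M, pullT f = φ := by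
  refine ⟨Over.homMk (ofPullSpec (R := .of (AddMonoidAlgebra ℂ M)) (CommRingCat.ofHom φ)) ?_, ?_⟩
  · apply pullSpec_injective (R := .of ℂ)
    ext c
    refine Eq.trans ?_ (h c)
    have h2 := pullSpec_comp_map (R := .of ℂ) (S := .of (AddMonoidAlgebra ℂ M))
      (ofPullSpec (R := .of (AddMonoidAlgebra ℂ M)) (CommRingCat.ofHom φ))
      (CommRingCat.ofHom (algebraMap ℂ (AddMonoidAlgebra ℂ M)))
    rw [pullSpec_ofPullSpec] at h2
    exact congr($h2 c)
  · exact congr(($(pullSpec_ofPullSpec (R := .of (AddMonoidAlgebra ℂ M))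
      (CommRingCat.ofHom φ))).hom)

lemma ringHom_ext_of_chi {A : Type*} [CommRing A] {f g : AddMonoidAlgebra ℂ M →+* A}
    (h : ∀ c, f (algebraMap ℂ _ c) = g (algebraMap ℂ _ c)) (h' : ∀ m, f (chi m) = g (chi m)) :
    f = g := by
  apply AddMonoidAlgebra.ringHom_ext
  · intro c; exact h c
  · exact h'

/-- A morphism to a torus as a family of invertible functions. -/
def charUnits (f : X ⟶ Torus M) : M →+ Additive Γ(X.left, ⊤)ˣ :=
  MonoidHom.toAdditiveRight (((pullT f : _ →* _).comp (AddMonoidAlgebra.of ℂ M)).toHomUnits)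

lemma charUnits_apply (f : X ⟶ Torus M) (m : M) :
    ((charUnits f m).toMul : Γ(X.left, ⊤)) = pullT f (chi m) := rfl

lemma charUnits_injective {f g : X ⟶ Torus M} (h : charUnits f = charUnits g) : f = g := by
  apply pullT_injective
  apply ringHom_ext_of_chi
  · intro c; rw [pullT_algebraMap, pullT_algebraMap]
  · intro m
    rw [← charUnits_apply, h, charUnits_apply]

/-- Universal property of the group algebra. Together with `charUnits_injective` it identifies
`X`-points of the torus with homomorphisms from `M` to the units of `X`. -/
lemma exists_charUnits_eq (u : M →+ Additive Γ(X.left, ⊤)ˣ) : ∃ f : X ⟶ Torus M, charUnits f = u := by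
  let _ : Algebra ℂ Γ(X.left, ⊤) := (constants X).toAlgebra
  obtain ⟨f, hf⟩ := exists_pullT_eq (X := X) (M := M)
    (AddMonoidAlgebra.lift ℂ Γ(X.left, ⊤) M
      ((Units.coeHom _).comp (AddMonoidHom.toMultiplicativeLeft u))).toRingHom
    (fun c => AlgHom.commutes _ c)
  refine ⟨f, ?_⟩
  ext m
  rw [charUnits_apply, hf]
  simp

lemma charUnits_comp (g : X' ⟶ X) (f : X ⟶ Torus M) :
    charUnits (g ≫ f) = (MonoidHom.toAdditive (Units.map (g.left.appTop.hom : _ →* _))).comp (charUnits f) := by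
  ext m
  simp [charUnits_apply, pullT_comp]

lemma charUnits_torusHom (f : X ⟶ Torus N) (φ : M →+ N) :
    charUnits (f ≫ torusHom φ) = (charUnits f).comp φ := by
  ext m
  simp [charUnits_apply, pullT_torusHom_single]

/-- Characters are group-like. The fibre product is transported to the spectrum of `ℂ[M] ⊗ ℂ[M]`,
where multiplication is dual to `χ ↦ χ ⊗ χ`. -/
lemma pullT_mul_chi (f g : X ⟶ Torus M) (m : M) :
    pullT (lift f g ≫ μ[Torus M]) (chi m) = pullT f (chi m) * pullT g (chi m) := by
  let A := AddMonoidAlgebra ℂ M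
  let l : X.left ⟶ Limits.pullback (Spec.map (CommRingCat.ofHom (algebraMap ℂ A)))
    (Spec.map (CommRingCat.ofHom (algebraMap ℂ A))) := (lift f g).left
  let h : X.left ⟶ Spec (.of (TensorProduct ℂ A A)) := l ≫ (pullbackSpecIso ℂ A A).hom
  have h1 : f.left = h ≫ Spec.map (CommRingCat.ofHom
      (Algebra.TensorProduct.includeLeftRingHom : A →+* TensorProduct ℂ A A)) := by
    rw [Category.assoc, pullbackSpecIso_hom_fst]
    exact congr(($(lift_fst f g)).left).symm
  have h2 : g.left = h ≫ Spec.map (CommRingCat.ofHom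
      (Algebra.TensorProduct.includeRight : A →ₐ[ℂ] TensorProduct ℂ A A).toRingHom) := by
    have : h ≫ Spec.map (CommRingCat.ofHom
      (Algebra.TensorProduct.includeRight : A →ₐ[ℂ] TensorProduct ℂ A A).toRingHom) =
      l ≫ Limits.pullback.snd _ _ := by
      rw [Category.assoc]
      exact congrArg (l ≫ ·) (pullbackSpecIso_hom_snd ℂ A A)
    rw [this]
    exact congr(($(lift_snd f g)).left).symm
  have h3 : (lift f g ≫ μ[Torus M]).left =
      h ≫ Spec.map (CommRingCat.ofHom (Bialgebra.comulAlgHom ℂ A).toRingHom) := by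
    rw [Category.assoc]
    rfl
  have e1 : pullT f (chi m) = pullSpec h (chi m ⊗ₜ[ℂ] 1) := by
    have := pullSpec_comp_map (R := .of A) (S := .of (TensorProduct ℂ A A)) h (CommRingCat.ofHom
      (Algebra.TensorProduct.includeLeftRingHom : A →+* TensorProduct ℂ A A))
    rw [← h1] at this
    exact congr($this (chi m))
  have e2 : pullT g (chi m) = pullSpec h (1 ⊗ₜ[ℂ] chi m) := by
    have := pullSpec_comp_map (R := .of A) (S := .of (TensorProduct ℂ A A)) h (CommRingCat.ofHom
      (Algebra.TensorProduct.includeRight : A →ₐ[ℂ] TensorProduct ℂ A A).toRingHom)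
    rw [← h2] at this
    exact congr($this (chi m))
  have e3 : pullT (lift f g ≫ μ[Torus M]) (chi m) = pullSpec h (chi m ⊗ₜ[ℂ] chi m) := by
    have := pullSpec_comp_map (R := .of A) (S := .of (TensorProduct ℂ A A)) h (CommRingCat.ofHom
      (Bialgebra.comulAlgHom ℂ A).toRingHom)
    rw [← h3] at this
    refine congr($this (chi m)).trans ?_
    have hc : Coalgebra.comul (R := ℂ) (chi m) = (chi m ⊗ₜ[ℂ] chi m : A ⊗[ℂ] A) := by
      rw [AddMonoidAlgebra.comul_single]
      simp
    exact congrArg (pullSpec h) hc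
  rw [e1, e2, e3, ← map_mul, Algebra.TensorProduct.tmul_mul_tmul, _root_.one_mul,
    _root_.mul_one]

lemma charUnits_mul (f g : X ⟶ Torus M) :
    charUnits (lift f g ≫ μ) = charUnits f + charUnits g := by
  ext m
  exact pullT_mul_chi f g m

lemma pullT_one_chi (m : M) : pullT (toUnit X ≫ η[Torus M]) (chi m) = 1 := by
  have h := pullSpec_comp_map (R := .of (AddMonoidAlgebra ℂ M)) (S := .of ℂ) (toUnit X).left
    (CommRingCat.ofHom (Bialgebra.counitAlgHom ℂ (AddMonoidAlgebra ℂ M)).toRingHom)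
  refine congr($h (chi m)).trans ?_
  have hc : Bialgebra.counitAlgHom ℂ (AddMonoidAlgebra ℂ M) (chi m) = 1 := by
    simp
  exact congrArg (pullSpec (R := .of ℂ) (toUnit X).left) hc |>.trans (map_one _)

lemma charUnits_one : charUnits (toUnit X ≫ η[Torus M]) = 0 := by
  ext m
  exact pullT_one_chi m

lemma torusHom_one (φ : M →+ N) : η[Torus N] ≫ torusHom φ = η[Torus M] := by
  apply charUnits_injective
  rw [charUnits_torusHom]
  have h1 : η[Torus N] = toUnit _ ≫ η[Torus N] := by
    rw [toUnit_unique (toUnit (𝟙_ (Over SpecC))) (𝟙 _), Category.id_comp]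
  have h2 : η[Torus M] = toUnit _ ≫ η[Torus M] := by
    rw [toUnit_unique (toUnit (𝟙_ (Over SpecC))) (𝟙 _), Category.id_comp]
  rw [h1, h2, charUnits_one, charUnits_one]
  simp

lemma torusHom_mul (φ : M →+ N) :
    μ[Torus N] ≫ torusHom φ = (torusHom φ ⊗ₘ torusHom φ) ≫ μ[Torus M] := by
  apply charUnits_injective
  have h1 : μ[Torus N] = lift (fst _ _) (snd _ _) ≫ μ[Torus N] := by simp
  have h2 : (torusHom φ ⊗ₘ torusHom φ) = lift (fst _ _ ≫ torusHom φ) (snd _ _ ≫ torusHom φ) := by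
    ext <;> simp
  rw [h1, h2, charUnits_torusHom, charUnits_mul, charUnits_mul, charUnits_torusHom, charUnits_torusHom]
  rfl

lemma torusHom_comp {P : Type} [AddCommGroup P] (φ : M →+ N) (ψ : N →+ P) :
    torusHom ψ ≫ torusHom φ = torusHom (ψ.comp φ) := by
  apply charUnits_injective
  have h : torusHom (ψ.comp φ) = 𝟙 _ ≫ torusHom (ψ.comp φ) := by simp
  have h' : torusHom ψ = 𝟙 _ ≫ torusHom ψ := by simp
  rw [h, h', charUnits_torusHom, charUnits_torusHom, charUnits_torusHom]
  rfl

end Torus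

/-! ### Expansions in characters -/

section Twist

variable {M : Type} [AddCommGroup M]

/-- A non-zero element of a free abelian group is detected by a homomorphism to `ℂˣ`. -/
lemma exists_unitChar_ne [Module.Free ℤ M] {m m' : M} (h : m ≠ m') :
    ∃ τ : M →+ Additive ℂˣ, τ m ≠ τ m' := by
  let b := Module.Free.chooseBasis ℤ M
  obtain ⟨i, hi⟩ : ∃ i, b.repr m i ≠ b.repr m' i := by
    by_contra! h'
    exact h (b.repr.injective (Finsupp.ext h'))
  let φ : M →+ ℤ := (b.coord i).toAddMonoidHom
  -- The character `m ↦ 2 ^ (i-th coordinate)` separates, as `2` is not a root of unity.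
  refine ⟨(zmultiplesHom (Additive ℂˣ) (Additive.ofMul (Units.mk0 2 two_ne_zero))).comp φ, ?_⟩
  intro h'
  have h2 : ((2 : ℂ)) ^ (b.repr m i) = 2 ^ (b.repr m' i) := by
    have := congr(((Additive.toMul $h' : ℂˣ) : ℂ))
    simpa [φ] using this
  apply hi
  have h3 : ((2 : ℝ)) ^ (b.repr m i) = 2 ^ (b.repr m' i) := by
    apply Complex.ofReal_injective
    push_cast
    exact h2
  exact zpow_right_injective₀ (by norm_num) (by norm_num) h3

/-- The automorphism of the group algebra given by a point of the torus. -/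
def twist (τ : M →+ Additive ℂˣ) : AddMonoidAlgebra ℂ M →ₐ[ℂ] AddMonoidAlgebra ℂ M :=
  AddMonoidAlgebra.lift ℂ _ M
    { toFun := fun m => AddMonoidAlgebra.single m.toAdd ((τ m.toAdd).toMul : ℂ)
      map_one' := by simp; rfl
      map_mul' := by intro m m'; simp [AddMonoidAlgebra.single_mul_single] }

lemma twist_single (τ : M →+ Additive ℂˣ) (m : M) (c : ℂ) :
    twist τ (.single m c) = .single m (((τ m).toMul : ℂ) * c) := by
  simp [twist, mul_comm]

lemma coeff_twist (τ : M →+ Additive ℂˣ) (f : AddMonoidAlgebra ℂ M) (m : M) :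
    (twist τ f).coeff m = ((τ m).toMul : ℂ) * f.coeff m := by
  classical
  induction f using AddMonoidAlgebra.induction_linear with
  | zero => simp
  | add f g hf hg => simp [hf, hg, mul_add]
  | single m' c =>
    rw [twist_single]
    by_cases h : m' = m
    · subst h; simp
    · simp [h]

/-- Induction on the number of characters occurring in `f`. If some `m' ≠ m` occurs, choose `τ`
separating them: `τ f - τ(m') f` stays in `V`, loses `m'` and keeps `m`. -/
lemma chi_mem_of_twist_mem [Module.Free ℤ M] (V : Submodule ℂ (AddMonoidAlgebra ℂ M))
    (hV : ∀ τ, ∀ f ∈ V, twist τ f ∈ V) {f : AddMonoidAlgebra ℂ M} (hf : f ∈ V) {m : M}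
    (hm : m ∈ f.coeff.support) : chi m ∈ V := by
  classical
  induction hn : f.coeff.support.card using Nat.strong_induction_on generalizing f with
  | _ n ih =>
  by_cases h : ∃ m' ∈ f.coeff.support, m' ≠ m
  · obtain ⟨m', hm', hne⟩ := h
    obtain ⟨τ, hτ⟩ := exists_unitChar_ne hne.symm
    have hc (x : M) : (twist τ f - ((τ m').toMul : ℂ) • f).coeff x =
        (((τ x).toMul : ℂ) - ((τ m').toMul : ℂ)) * f.coeff x := by
      simp [coeff_twist, sub_mul]
    have hlt : (twist τ f - ((τ m').toMul : ℂ) • f).coeff.support ⊂ f.coeff.support := by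
      refine Finset.ssubset_iff_of_subset (fun x hx => ?_) |>.mpr ⟨m', hm', ?_⟩
      · rw [Finsupp.mem_support_iff, hc] at hx
        exact Finsupp.mem_support_iff.mpr (right_ne_zero_of_mul hx)
      · rw [Finsupp.notMem_support_iff, hc]; simp
    refine ih _ (hn ▸ Finset.card_lt_card hlt)
      (V.sub_mem (hV τ f hf) (V.smul_mem _ hf)) ?_ rfl
    rw [Finsupp.mem_support_iff, hc]
    refine mul_ne_zero (sub_ne_zero.mpr fun h' => hτ ?_) (Finsupp.mem_support_iff.mp hm)
    exact Additive.toMul.injective (Units.ext h')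
  · push Not at h
    have h1 : f = AddMonoidAlgebra.single m (f.coeff m) := by
      ext x
      by_cases hx : x = m
      · subst hx; simp
      · have : f.coeff x = 0 := by
          by_contra h0
          exact hx (h x (Finsupp.mem_support_iff.mpr h0))
        simp [this, Ne.symm hx]
    have h2 : chi m = (f.coeff m)⁻¹ • f := by
      rw [h1]
      simp [Finsupp.mem_support_iff.mp hm]
    rw [h2]
    exact V.smul_mem _ hf

end Twist

/-! ### Global functions on a toric variety -/

namespace ToricVariety

variable {M : Type} [AddCommGroup M] (Y : ToricVariety M) {X : Over SpecC}

lemma pullT_expand (f : X ⟶ Torus M) (w : Γ(Y.V.left, ⊤)) :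
    pullT f (Y.expand w) = (f ≫ Y.emb).left.appTop w := by
  have h : (Scheme.ΓSpecIso (.of (AddMonoidAlgebra ℂ M))).inv (Y.expand w) =
      Y.emb.left.appTop w := by
    exact congr($((Scheme.ΓSpecIso (.of (AddMonoidAlgebra ℂ M))).hom_inv_id) (Y.emb.left.appTop w))
  have h2 : pullT f (Y.expand w) = f.left.appTop (Y.emb.left.appTop w) := by
    rw [← h]; rfl
  rw [h2, Over.comp_left, Scheme.Hom.comp_appTop]
  rfl

lemma pullT_id_injective : Function.Injective (pullT (𝟙 (Torus M))) := by
  have h := pullSpec_id (R := .of (AddMonoidAlgebra ℂ M))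
  have h2 : pullT (𝟙 (Torus M)) = (Scheme.ΓSpecIso (.of (AddMonoidAlgebra ℂ M))).inv.hom :=
    congr(($h).hom)
  rw [h2]
  exact (Scheme.ΓSpecIso (.of (AddMonoidAlgebra ℂ M))).symm.commRingCatIsoToRingEquiv.injective

/-- On an integral scheme, restriction to a non-empty open subset is injective. -/
lemma expand_injective : Function.Injective Y.expand := by
  have : Nonempty (Torus M).left := inferInstanceAs <| Nonempty
    (PrimeSpectrum (AddMonoidAlgebra ℂ M))
  have : Nonempty (Y.emb.left ''ᵁ ⊤ : Y.V.left.Opens) :=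
    ⟨⟨Y.emb.left this.some, ⟨this.some, trivial, rfl⟩⟩⟩
  have h1 : Y.emb.left.appTop = Y.V.left.presheaf.map (homOfLE le_top).op ≫
      (Y.emb.left.appIso ⊤).hom := by
    rw [Scheme.Hom.appIso_hom', Scheme.Hom.map_appLE]
    exact (Scheme.Hom.appLE_eq_app Y.emb.left).symm
  intro w w' h
  apply map_injective_of_isIntegral Y.V.left
    (homOfLE le_top : (Y.emb.left ''ᵁ ⊤ : Y.V.left.Opens) ⟶ ⊤)
  apply (Y.emb.left.appIso ⊤).commRingCatIsoToRingEquiv.injective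
  have h2 : Y.emb.left.appTop w = Y.emb.left.appTop w' :=
    (Scheme.ΓSpecIso (.of (AddMonoidAlgebra ℂ M))).commRingCatIsoToRingEquiv.injective h
  rw [h1] at h2
  exact h2

lemma appTop_constants {X X' : Over SpecC} (g : X' ⟶ X) (c : ℂ) :
    g.left.appTop (constants X c) = constants X' c := by
  rw [constants_eq_pullSpec, constants_eq_pullSpec, ← Over.w g, pullSpec_comp (R := .of ℂ)]
  rfl

lemma expand_constants (c : ℂ) : Y.expand (constants Y.V c) = algebraMap ℂ _ c := by
  apply pullT_id_injective
  rw [pullT_expand, pullT_algebraMap, appTop_constants]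

/-- A point `τ` of the torus acts on all of `Y` and restricts to translation on the torus, which
multiplies each character by its value at `τ`. -/
lemma exists_expand_eq_twist (τ : M →+ Additive ℂˣ) (w : Γ(Y.V.left, ⊤)) :
    ∃ w', Y.expand w' = twist τ (Y.expand w) := by
  -- The constant morphism from `Y` to its torus with value `τ`.
  obtain ⟨t, ht⟩ := exists_charUnits_eq (X := Y.V)
    ((MonoidHom.toAdditive (Units.map (constants Y.V).toMonoidHom)).comp τ)
  refine ⟨(lift t (𝟙 Y.V) ≫ γ[Torus M, Y.V]).left.appTop w, ?_⟩
  have h1 : Y.emb ≫ lift t (𝟙 Y.V) ≫ γ[Torus M, Y.V] =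
      (lift (Y.emb ≫ t) (𝟙 _) ≫ μ[Torus M]) ≫ Y.emb := by
    rw [Category.assoc, ← Y.act_emb, ← Category.assoc, comp_lift, ← Category.assoc,
      lift_whiskerLeft]
    simp
  have h2 : pullT (lift (Y.emb ≫ t) (𝟙 _) ≫ μ[Torus M]) =
      (pullT (𝟙 (Torus M))).comp (twist τ).toRingHom := by
    apply ringHom_ext_of_chi
    · intro c
      rw [pullT_algebraMap]
      refine (pullT_algebraMap (𝟙 (Torus M)) c).symm.trans ?_
      exact congrArg (pullT (𝟙 (Torus M))) ((twist τ).commutes c).symm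
    · intro m
      have h3 : pullT t (chi m) = constants Y.V ((τ m).toMul : ℂ) :=
        congr(((Additive.toMul ($ht m) : _ˣ) : Γ(Y.V.left, ⊤)))
      have h4 : twist τ (chi m) = algebraMap ℂ _ ((τ m).toMul : ℂ) * chi m := by
        simp [twist_single, AddMonoidAlgebra.single_mul_single]
      rw [pullT_mul_chi, pullT_comp_apply, h3]
      refine Eq.trans ?_ (congrArg (pullT (𝟙 (Torus M))) h4).symm
      rw [map_mul, pullT_algebraMap, appTop_constants]
  apply pullT_id_injective
  rw [pullT_expand, Category.id_comp]
  have h5 := congr(($h1).left.appTop w)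
  rw [Over.comp_left, Scheme.Hom.comp_appTop] at h5
  refine h5.trans ?_
  rw [← pullT_expand, h2]
  rfl

/-- The functions on the torus that extend to `Y` form a subspace stable under translations, so each
character occurring in one of them extends too. -/
lemma exists_expand_eq_chi [Module.Free ℤ M] {w : Γ(Y.V.left, ⊤)} {m : M}
    (hm : m ∈ (Y.expand w).coeff.support) : ∃ w', Y.expand w' = chi m := by
  let V : Submodule ℂ (AddMonoidAlgebra ℂ M) :=
    { Y.expand.range with
      smul_mem' := by
        rintro c _ ⟨w, rfl⟩
        exact ⟨constants Y.V c * w, by rw [map_mul, expand_constants, Algebra.smul_def]⟩ }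
  refine chi_mem_of_twist_mem V ?_ (f := Y.expand w) ⟨w, rfl⟩ hm
  rintro τ _ ⟨w, rfl⟩
  exact Y.exists_expand_eq_twist τ w

end ToricVariety

/-! ### The ideal sheaf of the vanishing scheme -/

section Vanishing

variable {Y : Scheme.{0}}

lemma IsGenerator.restrict {L : Y.Modules} {U V : Y.Opens} {s : Γ(L, U)} (hs : IsGenerator L s)
    (h : V ≤ U) : IsGenerator L (L.presheaf.map (homOfLE h).op s : Γ(L, V)) := by
  intro W hW
  have h1 := hs W (hW.trans h)
  have h2 : (L.presheaf.map (homOfLE hW).op (L.presheaf.map (homOfLE h).op s) : Γ(L, W)) =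
      L.presheaf.map (homOfLE (hW.trans h)).op s := by
    rw [← ConcreteCategory.comp_apply, ← Functor.map_comp]
    rfl
  rw [h2]
  exact h1

variable {r : ℕ} (L : Fin r → Y.Modules) (ℓ : ∀ k, Γ(L k, ⊤))

/-- All the line bundles are trivial over `U`. -/
def IsTrivializing (U : Y.Opens) : Prop :=
  ∀ k, ∃ s : Γ(L k, U), IsGenerator (L k) s

/-- The ideal generated by the coordinates over `U` of the sections `ℓ k`. -/
def coordIdeal (U : Y.Opens) : Ideal Γ(Y, U) :=
  Ideal.span {f | ∃ (k : Fin r) (s : Γ(L k, U)), IsGenerator (L k) s ∧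
    (L k).presheaf.map (homOfLE le_top).op (ℓ k) = f • s}

lemma vanishingIdeal_eq_sInf :
    vanishingIdeal L ℓ = sInf {J | ∀ U : Y.affineOpens, coordIdeal L ℓ U.1 ≤ J.ideal U} := by
  unfold vanishingIdeal
  congr 1
  ext J
  simp only [Set.mem_ofPred_eq, coordIdeal, Ideal.span_le]
  constructor
  · rintro h U f ⟨k, s, hs, hf⟩
    exact h k U s hs f hf
  · rintro h k U s hs f hf
    exact h U ⟨k, s, hs, hf⟩

variable {L}

lemma map_map_section {L : Y.Modules} {U V W : Y.Opens} (h : V ≤ U) (h' : W ≤ V) (s : Γ(L, U)) :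
    (L.presheaf.map (homOfLE h').op (L.presheaf.map (homOfLE h).op s) : Γ(L, W)) =
      L.presheaf.map (homOfLE (h'.trans h)).op s := by
  rw [← ConcreteCategory.comp_apply, ← Functor.map_comp]
  rfl

/-- On `U ⊓ V` one generator is a multiple of the other, so the coordinate over `U` is a multiple of
the coordinate over `V`. As `j` lands in `V`, nothing of the preimage of `U` is lost by passing to
`U ⊓ V`. -/
lemma coordIdeal_le_ker {V : Y.Opens} (hV : IsTrivializing L V) {Z : Scheme.{0}} (j : Z ⟶ Y)
    (e : ⊤ ≤ j ⁻¹ᵁ V) (h : ∀ g ∈ coordIdeal L ℓ V, j.appLE V ⊤ e g = 0) (U : Y.Opens) :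
    coordIdeal L ℓ U ≤ RingHom.ker (j.app U).hom := by
  rw [coordIdeal, Ideal.span_le]
  rintro f ⟨k, s, hs, hf⟩
  obtain ⟨s', hs'⟩ := hV k
  obtain ⟨g, hg⟩ := (hs' V le_rfl).surjective ((L k).presheaf.map (homOfLE le_top).op (ℓ k))
  have hg : (L k).presheaf.map (homOfLE le_top).op (ℓ k) = g • s' := by
    rw [← hg]
    simp
  obtain ⟨u, hu⟩ := (hs (U ⊓ V) inf_le_left).surjective
    ((L k).presheaf.map (homOfLE inf_le_right).op s')
  have h1 := congrArg ((L k).presheaf.map (homOfLE (inf_le_left : U ⊓ V ≤ U)).op) hf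
  have h2 := congrArg ((L k).presheaf.map (homOfLE (inf_le_right : U ⊓ V ≤ V)).op) hg
  rw [map_map_section, Scheme.Modules.map_smul] at h1 h2
  dsimp only at hu
  rw [h1, ← hu, smul_smul] at h2
  have h3 : Y.presheaf.map (homOfLE (inf_le_left : U ⊓ V ≤ U)).op f =
    Y.presheaf.map (homOfLE (inf_le_right : U ⊓ V ≤ V)).op g * u :=
    (hs (U ⊓ V) inf_le_left).injective h2
  have e1 : j ⁻¹ᵁ U ≤ j ⁻¹ᵁ (U ⊓ V) := fun x hx => ⟨hx, e trivial⟩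
  have h4 : j.app U f = j.appLE (U ⊓ V) (j ⁻¹ᵁ U) e1
      (Y.presheaf.map (homOfLE (inf_le_left : U ⊓ V ≤ U)).op f) := by
    rw [← ConcreteCategory.comp_apply, Scheme.Hom.map_appLE, Scheme.Hom.app_eq_appLE]
  have h5 : j.appLE (U ⊓ V) (j ⁻¹ᵁ U) e1
      (Y.presheaf.map (homOfLE (inf_le_right : U ⊓ V ≤ V)).op g) = 0 := by
    rw [← ConcreteCategory.comp_apply, Scheme.Hom.map_appLE,
      ← Scheme.Hom.appLE_map j e (homOfLE le_top).op, ConcreteCategory.comp_apply,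
      h g (Ideal.subset_span ⟨k, s', hs', hg⟩), map_zero]
  change j.app U f = 0
  rw [h4, h3, map_mul, h5, zero_mul]

/-- The inclusion of the closed subscheme of an affine open subset given by an ideal. -/
def closedInAffine {V : Y.Opens} (hV : IsAffineOpen V) (I : Ideal Γ(Y, V)) :
    Spec (.of (Γ(Y, V) ⧸ I)) ⟶ Y :=
  Spec.map (CommRingCat.ofHom (Ideal.Quotient.mk I)) ≫ hV.fromSpec

lemma top_le_preimage_closedInAffine {V : Y.Opens} (hV : IsAffineOpen V) (I : Ideal Γ(Y, V)) :
    ⊤ ≤ closedInAffine hV I ⁻¹ᵁ V := by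
  intro x _
  have := Set.mem_range_self (f := hV.fromSpec) (Spec.map (CommRingCat.ofHom (Ideal.Quotient.mk I)) x)
  rw [hV.range_fromSpec] at this
  exact this

lemma appLE_comp_fromSpec {V : Y.Opens} (hV : IsAffineOpen V) {Z : Scheme.{0}}
    (f : Z ⟶ Spec Γ(Y, V)) (e : ⊤ ≤ (f ≫ hV.fromSpec) ⁻¹ᵁ V) :
    (f ≫ hV.fromSpec).appLE V ⊤ e = pullSpec f := by
  have e' : ⊤ ≤ f ⁻¹ᵁ (hV.fromSpec ⁻¹ᵁ V) := e
  refine (Scheme.Hom.comp_appLE f hV.fromSpec V ⊤ e).trans ?_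
  change hV.fromSpec.app V ≫ f.appLE (hV.fromSpec ⁻¹ᵁ V) ⊤ e' = _
  rw [hV.fromSpec_app_self, Category.assoc, Scheme.Hom.map_appLE]
  rw [pullSpec]
  congr 1
  exact Scheme.Hom.appLE_eq_app f

lemma appLE_closedInAffine {V : Y.Opens} (hV : IsAffineOpen V) (I : Ideal Γ(Y, V)) :
    (closedInAffine hV I).appLE V ⊤ (top_le_preimage_closedInAffine hV I) =
      CommRingCat.ofHom (Ideal.Quotient.mk I) ≫ (Scheme.ΓSpecIso _).inv := by
  have h := pullSpec_comp_map (𝟙 (Spec (.of (Γ(Y, V) ⧸ I))))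
    (CommRingCat.ofHom (Ideal.Quotient.mk I))
  rw [Category.id_comp, pullSpec_id] at h
  exact (appLE_comp_fromSpec hV _ _).trans h

lemma appLE_closedInAffine_eq_zero {V : Y.Opens} (hV : IsAffineOpen V) (I : Ideal Γ(Y, V))
    (g : Γ(Y, V)) (hg : g ∈ I) :
    (closedInAffine hV I).appLE V ⊤ (top_le_preimage_closedInAffine hV I) g = 0 := by
  rw [appLE_closedInAffine, ConcreteCategory.comp_apply]
  have h : (CommRingCat.ofHom (Ideal.Quotient.mk I)) g = 0 :=
    Ideal.Quotient.eq_zero_iff_mem.mpr hg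
  rw [h, map_zero]

/-- The equations make `j` factor through the closed subscheme of `V`. -/
lemma ker_closedInAffine_le {V : Y.Opens} (hV : IsAffineOpen V) (I : Ideal Γ(Y, V))
    {Z : Scheme.{0}} (j : Z ⟶ Y) (e : ⊤ ≤ j ⁻¹ᵁ V) (h : ∀ g ∈ I, j.appLE V ⊤ e g = 0) :
    (closedInAffine hV I).ker ≤ j.ker := by
  have hr : Set.range j ⊆ Set.range hV.fromSpec := by
    rw [hV.range_fromSpec]
    rintro _ ⟨z, rfl⟩
    exact e (x := z) trivial
  obtain ⟨f, rfl⟩ : ∃ f, f ≫ hV.fromSpec = j :=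
    ⟨_, IsOpenImmersion.lift_fac hV.fromSpec j hr⟩
  rw [appLE_comp_fromSpec] at h
  let φ : CommRingCat.of (Γ(Y, V) ⧸ I) ⟶ Γ(Z, ⊤) :=
    CommRingCat.ofHom (Ideal.Quotient.lift I (pullSpec f).hom h)
  have hf : f = ofPullSpec φ ≫ Spec.map (CommRingCat.ofHom (Ideal.Quotient.mk I)) := by
    apply pullSpec_injective
    rw [pullSpec_comp_map, pullSpec_ofPullSpec]
    rfl
  rw [hf, Category.assoc]
  exact Scheme.Hom.le_ker_comp _ _

lemma ideal_ker_closedInAffine [QuasiSeparatedSpace Y] {V : Y.Opens} (hV : IsAffineOpen V)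
    (I : Ideal Γ(Y, V)) : (closedInAffine hV I).ker.ideal ⟨V, hV⟩ ≤ I := by
  rw [Scheme.Hom.ker_apply]
  intro f hf
  have hf : (closedInAffine hV I).app V f = 0 := hf
  have h : (closedInAffine hV I).appLE V ⊤ (top_le_preimage_closedInAffine hV I) f = 0 := by
    rw [Scheme.Hom.appLE, ConcreteCategory.comp_apply, hf, map_zero]
  rw [appLE_closedInAffine] at h
  have h2 : (Ideal.Quotient.mk I) f = 0 :=
    (Scheme.ΓSpecIso (.of (Γ(Y, V) ⧸ I))).symm.commRingCatIsoToRingEquiv.injective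
      (h.trans (map_zero _).symm)
  exact Ideal.Quotient.eq_zero_iff_mem.mp h2

lemma exists_finite_trivializing_cover [CompactSpace Y] (hL : ∀ k, IsLineBundle (L k)) :
    ∃ F : Set Y.affineOpens, F.Finite ∧ (∀ U ∈ F, IsTrivializing L U.1) ∧
      ⨆ U : F, U.1.1 = ⊤ := by
  have h1 (y : Y) : ∃ U : Y.affineOpens, y ∈ U.1 ∧ IsTrivializing L U.1 := by
    choose U hy s hs using fun k => hL k y
    have hy' : y ∈ (⨅ k, U k : Y.Opens) := by
      rw [← SetLike.mem_coe, TopologicalSpace.Opens.coe_iInf]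
      exact Set.mem_iInter.mpr hy
    obtain ⟨V, hV, hyV, hVU⟩ := Y.isBasis_affineOpens.exists_subset_of_mem_open hy'
      (⨅ k, U k : Y.Opens).isOpen
    obtain ⟨V, hV', rfl⟩ := hV
    refine ⟨⟨V, hV'⟩, hyV, fun k => ⟨_, (hs k).restrict (le_trans ?_ (iInf_le U k))⟩⟩
    exact hVU
  choose U hyU hU using h1
  obtain ⟨t, ht⟩ := isCompact_univ.elim_finite_subcover (fun y => ((U y).1 : Set Y))
    (fun y => (U y).1.isOpen) (fun y _ => Set.mem_iUnion.mpr ⟨y, hyU y⟩)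
  refine ⟨U '' t, t.finite_toSet.image U, ?_, ?_⟩
  · rintro _ ⟨y, _, rfl⟩
    exact hU y
  · refine top_le_iff.mp fun y hy => ?_
    obtain ⟨z, hz, hyz⟩ := Set.mem_iUnion₂.mp (ht hy)
    exact TopologicalSpace.Opens.mem_iSup.mpr ⟨⟨U z, z, hz, rfl⟩, hyz⟩

variable [CompactSpace Y] [QuasiSeparatedSpace Y]

/-- Not immediate from the definition, since an infinite infimum of ideal sheaves need not be
computed section by section. A finite trivializing cover provides a finite infimum `J₀` which
contains all coordinates and lies below every competitor. -/
lemma coordIdeal_le_vanishingIdeal (hL : ∀ k, IsLineBundle (L k)) (U : Y.affineOpens) :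
    coordIdeal L ℓ U.1 ≤ (vanishingIdeal L ℓ).ideal U := by
  obtain ⟨F, hF, hF', hcov⟩ := exists_finite_trivializing_cover hL
  have := hF.to_subtype
  let J₀ : Y.IdealSheafData := ⨅ V : F, (closedInAffine V.1.2 (coordIdeal L ℓ V.1.1)).ker
  have h1 (U) : coordIdeal L ℓ U.1 ≤ J₀.ideal U := by
    simp only [J₀, Scheme.IdealSheafData.ideal_iInf, iInf_apply, Scheme.Hom.ker_apply]
    refine le_iInf fun V => ?_
    refine coordIdeal_le_ker ℓ (hF' V.1 V.2) _ (top_le_preimage_closedInAffine V.1.2 _) 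
      (appLE_closedInAffine_eq_zero V.1.2 _) U.1
  refine (h1 U).trans ((?_ : J₀ ≤ vanishingIdeal L ℓ) U)
  rw [vanishingIdeal_eq_sInf]
  refine le_sInf fun J hJ => ?_
  -- Comparison on the members of the cover suffices; over `V` the kernel is contained in the
  -- coordinate ideal itself.
  refine Scheme.IdealSheafData.le_of_iSup_eq_top (fun V : F => V.1) hcov fun V => ?_
  refine le_trans ?_ ((ideal_ker_closedInAffine V.1.2 (coordIdeal L ℓ V.1.1)).trans (hJ V.1))
  exact (iInf_le _ V : J₀ ≤ _) V.1

/-- A morphism into a trivializing affine open lands in the zero locus iff the coordinates there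
pull back to zero. For the converse, the ideal sheaf of the closed subscheme of `V` is itself one of
those in the infimum. -/
lemma vanishingIdeal_le_ker_iff (hL : ∀ k, IsLineBundle (L k)) {V : Y.Opens} (hV : IsAffineOpen V)
    (hV' : IsTrivializing L V) {Z : Scheme.{0}} (j : Z ⟶ Y) (e : ⊤ ≤ j ⁻¹ᵁ V) :
    vanishingIdeal L ℓ ≤ j.ker ↔ ∀ g ∈ coordIdeal L ℓ V, j.appLE V ⊤ e g = 0 := by
  constructor
  · intro h g hg
    have h1 : j.app V g = 0 := Scheme.Hom.ideal_ker_le j ⟨V, hV⟩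
      (h ⟨V, hV⟩ (coordIdeal_le_vanishingIdeal ℓ hL ⟨V, hV⟩ hg))
    rw [Scheme.Hom.appLE, ConcreteCategory.comp_apply, h1, map_zero]
  · intro h
    refine le_trans ?_ (ker_closedInAffine_le hV _ j e h)
    rw [vanishingIdeal_eq_sInf]
    refine sInf_le fun U => ?_
    rw [Scheme.Hom.ker_apply]
    refine coordIdeal_le_ker ℓ hV' _ (top_le_preimage_closedInAffine hV _) 
      (appLE_closedInAffine_eq_zero hV _) U.1

end Vanishing

namespace ToricCI

variable {M : Type} [AddCommGroup M] {r : ℕ} (A : ToricCI M r)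

/-! ### Coordinates of the sections on the torus -/

lemma top_le_preimage_torusOpen (Y : ToricVariety M) : ⊤ ≤ Y.emb.left ⁻¹ᵁ Y.torusOpen :=
  fun t _ => ⟨t, rfl⟩

lemma isAffineOpen_torusOpen (Y : ToricVariety M) : IsAffineOpen Y.torusOpen := by
  have : IsAffine (Torus M).left := inferInstanceAs <| IsAffine
    (Spec (.of (AddMonoidAlgebra ℂ M)))
  exact isAffineOpen_opensRange Y.emb.left

/-- Functions on the torus of `Y` as elements of the group algebra. -/
def expandTorus (Y : ToricVariety M) : Γ(Y.V.left, Y.torusOpen) →+* AddMonoidAlgebra ℂ M :=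
  (Scheme.ΓSpecIso (.of (AddMonoidAlgebra ℂ M))).hom.hom.comp
    (Y.emb.left.appLE Y.torusOpen ⊤ (top_le_preimage_torusOpen Y)).hom

lemma pullT_expandTorus (Y : ToricVariety M) {X : Over SpecC} (f : X ⟶ Torus M)
    (e : ⊤ ≤ (f ≫ Y.emb).left ⁻¹ᵁ Y.torusOpen) (g : Γ(Y.V.left, Y.torusOpen)) :
    pullT f (expandTorus Y g) = (f ≫ Y.emb).left.appLE Y.torusOpen ⊤ e g := by
  have h : (Scheme.ΓSpecIso (.of (AddMonoidAlgebra ℂ M))).inv (expandTorus Y g) =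
      Y.emb.left.appLE Y.torusOpen ⊤ (top_le_preimage_torusOpen Y) g :=
    congr($((Scheme.ΓSpecIso (.of (AddMonoidAlgebra ℂ M))).hom_inv_id)
      (Y.emb.left.appLE Y.torusOpen ⊤ (top_le_preimage_torusOpen Y) g))
  have h2 : pullT f (expandTorus Y g) =
      f.left.appTop (Y.emb.left.appLE Y.torusOpen ⊤ (top_le_preimage_torusOpen Y) g) := by
    rw [← h]; rfl
  have h3 : f.left.appTop = f.left.appLE ⊤ ⊤ le_rfl := (Scheme.Hom.appLE_eq_app f.left).symm
  rw [h2, h3]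
  exact congr($(Scheme.Hom.appLE_comp_appLE f.left Y.emb.left Y.torusOpen ⊤ ⊤
    (top_le_preimage_torusOpen Y) le_rfl) g)

lemma exists_coord (k : Fin r) : ∃ g : Γ(A.Y.V.left, A.Y.torusOpen),
    (A.L k).presheaf.map (homOfLE le_top).op (A.ℓ k) = g • A.e k := by
  obtain ⟨g, hg⟩ := (A.e_generator k A.Y.torusOpen le_rfl).surjective
    ((A.L k).presheaf.map (homOfLE le_top).op (A.ℓ k))
  refine ⟨g, ?_⟩
  rw [← hg]
  simp

/-- The coordinate of the section `ℓ k` with respect to the trivialization `e k`, as a function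
on the torus of `Y`. -/
def coordOpen (k : Fin r) : Γ(A.Y.V.left, A.Y.torusOpen) := (A.exists_coord k).choose

/-- The coordinate of the section `ℓ k` with respect to the trivialization `e k`. -/
def coord (k : Fin r) : AddMonoidAlgebra ℂ M := expandTorus A.Y (A.coordOpen k)

lemma coordOpen_spec (k : Fin r) :
    (A.L k).presheaf.map (homOfLE le_top).op (A.ℓ k) = A.coordOpen k • A.e k :=
  (A.exists_coord k).choose_spec

lemma coordIdeal_torusOpen : coordIdeal A.L A.ℓ A.Y.torusOpen =
    Ideal.span (Set.range A.coordOpen) := by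
  apply le_antisymm
  · rw [coordIdeal, Ideal.span_le]
    rintro f ⟨k, s, hs, hf⟩
    obtain ⟨u, hu⟩ := (hs A.Y.torusOpen le_rfl).surjective (A.e k)
    have hu : u • s = A.e k := by
      rw [← hu]
      simp
    have h := A.coordOpen_spec k
    rw [hf, ← hu, smul_smul] at h
    have h' : f = A.coordOpen k * u := by
      apply (hs A.Y.torusOpen le_rfl).injective
      simpa using h
    rw [h']
    exact Ideal.mul_mem_right _ _ (Ideal.subset_span ⟨k, rfl⟩)
  · rw [Ideal.span_le]
    rintro _ ⟨k, rfl⟩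
    exact Ideal.subset_span ⟨k, A.e k, A.e_generator k, A.coordOpen_spec k⟩

/-- Turns the condition of lying over `Z` into `r` equations in `ℂ[M]`. -/
lemma idealZ_le_ker_iff {X : Over SpecC} (q : X ⟶ Torus M) :
    A.idealZ ≤ (q ≫ A.Y.emb).left.ker ↔ ∀ k, pullT q (A.coord k) = 0 := by
  have h1 : CompactSpace A.Y.V.left := by
    have := A.Y.quasiCompact
    exact QuasiCompact.compactSpace_of_compactSpace A.Y.V.hom
  have h2 : QuasiSeparatedSpace A.Y.V.left := by
    have := A.Y.separated
    exact quasiSeparatedSpace_of_quasiSeparated A.Y.V.hom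
  have e : ⊤ ≤ (q ≫ A.Y.emb).left ⁻¹ᵁ A.Y.torusOpen := fun x _ => ⟨q.left x, rfl⟩
  refine (vanishingIdeal_le_ker_iff A.ℓ A.isLineBundle (isAffineOpen_torusOpen A.Y)
    (fun k => ⟨_, A.e_generator k⟩) (q ≫ A.Y.emb).left e).trans ?_
  rw [coordIdeal_torusOpen]
  constructor
  · intro h k
    rw [coord, pullT_expandTorus A.Y q e]
    exact h _ (Ideal.subset_span ⟨k, rfl⟩)
  · intro h
    change Ideal.span (Set.range A.coordOpen) ≤ RingHom.ker (Scheme.Hom.appLE _ _ _ e).hom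
    rw [Ideal.span_le]
    rintro _ ⟨k, rfl⟩
    have := h k
    rw [coord, pullT_expandTorus A.Y q e] at this
    exact this

/-! ### The expansion of the superpotential -/

/-- Over the torus of `Y` one has `ℓ k = coord k • e k`, and `e k` as a function is a basis
character. -/
lemma expand_Wpart (k : Fin r) : A.X.expand (A.Wpart k) =
    AddMonoidAlgebra.mapDomainRingHom ℂ (AddMonoidHom.inl M (Fin r → ℤ)) (A.coord k) *
      chi (0, Pi.single k 1) := by
  apply ToricVariety.pullT_id_injective
  rw [ToricVariety.pullT_expand, Category.id_comp, map_mul]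
  have e1 := A.preimage_torus
  have h1 : A.X.emb.left.appTop (A.Wpart k) =
      A.X.emb.left.appLE (A.p.left ⁻¹ᵁ A.Y.torusOpen) ⊤ e1
        ((A.ξ k).map A.Y.torusOpen (A.coordOpen k • A.e k)) := by
    rw [← coordOpen_spec, (A.ξ k).map_restrict, ← ConcreteCategory.comp_apply,
      Scheme.Hom.map_appLE]
    exact congr($((Scheme.Hom.appLE_eq_app A.X.emb.left).symm) (A.Wpart k))
  rw [h1, (A.ξ k).map_smul, map_mul]
  congr 1
  · have h2 := pullT_torusHom (𝟙 _) (AddMonoidHom.inl M (Fin r → ℤ))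
    rw [Category.id_comp] at h2
    have e : ⊤ ≤ (torusHom (AddMonoidHom.inl M (Fin r → ℤ)) ≫ A.Y.emb).left ⁻¹ᵁ A.Y.torusOpen :=
      fun x _ => ⟨_, rfl⟩
    refine Eq.trans ?_ congr($h2 (A.coord k))
    rw [coord, pullT_expandTorus A.Y _ e]
    simp only [← A.emb_p]
    rw [← ConcreteCategory.comp_apply, Scheme.Hom.app_eq_appLE, Scheme.Hom.appLE_comp_appLE]
    rfl
  · refine (A.e_character k).trans ?_
    exact congr($((pullSpec_id (R := .of (AddMonoidAlgebra ℂ (M × (Fin r → ℤ))))).symm) _)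

end ToricCI

/-! ### Morphisms to locally closed subschemes -/

section SubObj

variable {X S : Over SpecC} {I : X.left.IdealSheafData} {U : I.subscheme.Opens}

instance : Mono (subIncl I U) :=
  have : Mono (subIncl I U).left := inferInstanceAs (Mono (U.ι ≫ I.subschemeι))
  Over.mono_of_mono_left _

lemma exists_comp_subIncl_eq (f : S ⟶ X) (hI : I ≤ f.left.ker)
    (hU : ∀ s : S.left, ∃ u ∈ U, I.subschemeι u = f.left s) :
    ∃ g : S ⟶ subObj I U, g ≫ subIncl I U = f := by
  obtain ⟨f', hf'⟩ : ∃ f', f' ≫ I.subschemeι = f.left :=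
    ⟨_, IsClosedImmersion.lift_fac I.subschemeι f.left (by rwa [Scheme.IdealSheafData.ker_subschemeι])⟩
  have hr : Set.range f' ⊆ Set.range U.ι := by
    rintro _ ⟨s, rfl⟩
    obtain ⟨u, hu, hus⟩ := hU s
    rw [← hf'] at hus
    have : u = f' s := I.subschemeι.injective hus
    subst this
    exact ⟨⟨_, hu⟩, rfl⟩
  obtain ⟨f'', hf''⟩ : ∃ f'', f'' ≫ U.ι = f' := ⟨_, IsOpenImmersion.lift_fac U.ι f' hr⟩
  have h : f'' ≫ U.ι ≫ I.subschemeι = f.left := by rw [← Category.assoc, hf'', hf']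
  refine ⟨Over.homMk f'' ?_, ?_⟩
  · change f'' ≫ (U.ι ≫ I.subschemeι) ≫ X.hom = S.hom
    rw [← Category.assoc, h, Over.w]
  · ext1
    exact h

lemma le_ker_comp_subIncl (g : S ⟶ subObj I U) : I ≤ (g ≫ subIncl I U).left.ker := by
  have h : (g ≫ subIncl I U).left = (g.left ≫ U.ι) ≫ I.subschemeι := (Category.assoc _ _ _).symm
  rw [h]
  exact (I.ker_subschemeι.ge).trans (Scheme.Hom.le_ker_comp _ _)

lemma exists_mem_subIncl (g : S ⟶ subObj I U) (s : S.left) :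
    ∃ u ∈ U, I.subschemeι u = (g ≫ subIncl I U).left s :=
  ⟨(U.ι (g.left s)), (g.left s).2, rfl⟩

lemma exists_subschemeι_eq (f : S ⟶ X) (hI : I ≤ f.left.ker) (s : S.left) :
    ∃ u, I.subschemeι u = f.left s := by
  obtain ⟨f', hf'⟩ : ∃ f', f' ≫ I.subschemeι = f.left :=
    ⟨_, IsClosedImmersion.lift_fac I.subschemeι f.left (by rwa [Scheme.IdealSheafData.ker_subschemeι])⟩
  exact ⟨f' s, by rw [← hf']; rfl⟩

end SubObj

/-- Pullback of ideal sheaves is left adjoint to pushforward. -/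
lemma ToricCI.idealS_le_ker_iff {M₁ M₂ : Type} [AddCommGroup M₁] [AddCommGroup M₂] {r : ℕ}
    (A : ToricCI M₁ r) (B : ToricCI M₂ r) (θ : CharX M₁ r ≃+ CharX M₂ r) {S : Over SpecC}
    (q : S ⟶ Torus (CharX M₁ r)) :
    idealS A B θ ≤ q.left.ker ↔
      A.idealZ ≤ (q ≫ proj₁ A).left.ker ∧ B.idealZ ≤ (q ≫ proj₂ B θ).left.ker := by
  rw [idealS, sup_le_iff, ← Scheme.IdealSheafData.le_map_iff_comap_le,
    ← Scheme.IdealSheafData.le_map_iff_comap_le, Scheme.IdealSheafData.map_ker,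
    Scheme.IdealSheafData.map_ker]
  rfl

/-! ### Matrices with vanishing row and column sums -/

section Matrix

variable {β K : Type*} {r : ℕ}

open scoped Classical in
/-- For a choice `ρ` of an index in each block, the matrix in which the columns with these indices
are replaced by unit vectors. -/
def rootedMatrix [CommRing K] (c : Fin r → β) (ρ : β → Fin r) (W : Matrix (Fin r) (Fin r) K) :
    Matrix (Fin r) (Fin r) K :=
  Matrix.of fun a b => if ρ (c b) = b then (if a = b then 1 else 0) else W a b

lemma rootedMatrix_map {K' : Type*} [CommRing K] [CommRing K'] (f : K →+* K') (c : Fin r → β)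
    (ρ : β → Fin r) (W : Matrix (Fin r) (Fin r) K) :
    (rootedMatrix c ρ W).map f = rootedMatrix c ρ (W.map f) := by
  ext a b
  simp only [rootedMatrix, Matrix.map_apply, Matrix.of_apply]
  split_ifs <;> simp

/-- Vectors constant on blocks lie in the kernel, so evaluation at the roots maps the kernel onto
`K^β`. The rank condition says that this map is injective, which amounts to injectivity of the
rooted matrix. -/
lemma rank_add_card_eq_iff [Field K] [Fintype β] (c : Fin r → β) (ρ : β → Fin r)
    (hρ : ∀ j, c (ρ j) = j) (W : Matrix (Fin r) (Fin r) K)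
    (hW : ∀ a b, c a ≠ c b → W a b = 0) (hrow : ∀ a, ∑ b, W a b = 0) (hcol : ∀ b, ∑ a, W a b = 0) :
    W.rank + Fintype.card β = r ↔ (rootedMatrix c ρ W).det ≠ 0 := by
  classical
  let ker := LinearMap.ker W.mulVecLin
  let res : ker →ₗ[K] (β → K) := (LinearMap.funLeft K K ρ).comp ker.subtype
  have hres (v : ker) (j : β) : res v j = v.1 (ρ j) := rfl
  have hsurj : Function.Surjective res := by
    intro u
    refine ⟨⟨fun b => u (c b), ?_⟩, ?_⟩
    · rw [LinearMap.mem_ker]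
      ext a
      simp only [Matrix.mulVecLin_apply, Matrix.mulVec, dotProduct, Pi.zero_apply]
      have : ∀ b, W a b * u (c b) = W a b * u (c a) := by
        intro b
        by_cases h : c a = c b
        · rw [h]
        · rw [hW a b h, zero_mul, zero_mul]
      simp_rw [this]
      rw [← Finset.sum_mul, hrow, zero_mul]
    · ext j
      rw [hres]
      exact congrArg u (hρ j)
  have hrank : W.rank + Module.finrank K ker = r := by
    have := LinearMap.finrank_range_add_finrank_ker W.mulVecLin
    simpa [Matrix.rank] using this
  have h1 : W.rank + Fintype.card β = r ↔ Function.Injective res := by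
    constructor
    · intro h
      rw [LinearMap.injective_iff_surjective_of_finrank_eq_finrank]
      · exact hsurj
      · rw [Module.finrank_fintype_fun_eq_card]
        omega
    · intro h
      have := (LinearEquiv.ofBijective res ⟨h, hsurj⟩).finrank_eq
      rw [Module.finrank_fintype_fun_eq_card] at this
      omega
  rw [h1, ← isUnit_iff_ne_zero, ← Matrix.isUnit_iff_isUnit_det, ← Matrix.mulVec_injective_iff_isUnit]
  -- The rooted matrix keeps the root coordinates of `v` and adds `W` applied to the remaining ones.
  have hG (v : Fin r → K) (a : Fin r) : (rootedMatrix c ρ W).mulVec v a =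
      (if ρ (c a) = a then v a else 0) + W.mulVec (fun b => if ρ (c b) = b then 0 else v b) a := by
    have h2 : (if ρ (c a) = a then v a else 0) =
        ∑ b, if ρ (c b) = b then (if a = b then v b else 0) else 0 := by
      rw [Finset.sum_eq_single a (fun b _ hb => by simp [hb.symm]) (by simp)]
      simp
    rw [h2]
    simp only [Matrix.mulVec, dotProduct, rootedMatrix, Matrix.of_apply]
    rw [← Finset.sum_add_distrib]
    refine Finset.sum_congr rfl fun b _ => ?_
    split_ifs <;> simp
  constructor
  · intro hinj
    rw [← Matrix.coe_mulVecLin, ← LinearMap.ker_eq_bot, LinearMap.ker_eq_bot']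
    intro v hv
    have hv (a) : (rootedMatrix c ρ W).mulVec v a = 0 := congrFun hv a
    -- Summing the entries of the image over block `j`, the contribution of `W` cancels by the
    -- column sums and only the root coordinate survives.
    have hroot (j : β) : v (ρ j) = 0 := by
      have hs : ∑ a, (if c a = j then (rootedMatrix c ρ W).mulVec v a else 0) = 0 := by
        simp [hv]
      have hc0 : ∑ a, (if c a = j then
          W.mulVec (fun b => if ρ (c b) = b then 0 else v b) a else 0) = 0 := by
        simp only [Matrix.mulVec, dotProduct, ← Finset.sum_filter]
        rw [Finset.sum_comm]
        refine Finset.sum_eq_zero fun b _ => ?_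
        rw [← Finset.sum_mul]
        by_cases hb : c b = j
        · have : ∑ a with c a = j, W a b = ∑ a, W a b := by
            rw [Finset.sum_filter]
            refine Finset.sum_congr rfl fun a _ => ?_
            split_ifs with h
            · rfl
            · exact (hW a b (by rw [hb]; exact h)).symm
          rw [this, hcol, zero_mul]
        · have : ∑ a with c a = j, W a b = 0 := by
            refine Finset.sum_eq_zero fun a ha => hW a b ?_
            rw [(Finset.mem_filter.mp ha).2]
            exact Ne.symm hb
          rw [this, zero_mul]
      simp only [hG] at hs
      have : ∀ a, (if c a = j then ((if ρ (c a) = a then v a else 0) +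
          W.mulVec (fun b => if ρ (c b) = b then 0 else v b) a) else 0) =
          (if c a = j then (if ρ (c a) = a then v a else 0) else 0) +
          (if c a = j then W.mulVec (fun b => if ρ (c b) = b then 0 else v b) a else 0) := by
        intro a
        split_ifs <;> simp
      simp only [this] at hs
      rw [Finset.sum_add_distrib, hc0, add_zero, Finset.sum_eq_single (ρ j)] at hs
      · simpa [hρ] using hs
      · intro a _ ha
        split_ifs with h h'
        · exact absurd (by rw [← h', h]) ha
        · rfl
        · rfl
      · simp
    have hroot' (b : Fin r) : (if ρ (c b) = b then 0 else v b) = v b := by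
      split_ifs with h
      · rw [← h, hroot]
      · rfl
    simp only [hG, hroot'] at hv
    have hker : v ∈ ker := by
      rw [LinearMap.mem_ker]
      ext a
      have := hv a
      split_ifs at this with h
      · rw [← h, hroot, zero_add, h] at this
        exact this
      · simpa using this
    have : (⟨v, hker⟩ : ker) = 0 := hinj (by ext j; simp [hres, hroot])
    exact congrArg Subtype.val this
  · intro hinj
    rw [← LinearMap.ker_eq_bot, LinearMap.ker_eq_bot']
    intro v hv
    have hv (j) : v.1 (ρ j) = 0 := congrFun hv j
    have hroot' (b : Fin r) : (if ρ (c b) = b then 0 else v.1 b) = v.1 b := by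
      split_ifs with h
      · rw [← h, hv]
      · rfl
    have : v.1 = 0 := by
      apply hinj
      ext a
      rw [hG, Matrix.mulVec_zero]
      simp only [hroot']
      have h3 : W.mulVec v.1 a = 0 := congrFun (LinearMap.mem_ker.mp v.2) a
      rw [h3]
      split_ifs with h
      · rw [← h, hv]; simp
      · simp
    exact Subtype.ext this

end Matrix

/-! ### Cofactors and left kernels -/

section Matrix

variable {β E : Type*} [CommRing E] {r : ℕ} (c : Fin r → β) (ρ : β → Fin r)

open scoped Classical in
/-- The row vector, built from cofactors, which up to the factor `det` spans the left kernel. -/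
def kernelVector (F : Matrix (Fin r) (Fin r) E) : Fin r → E :=
  Matrix.vecMul (fun b => if ρ (c b) = b then 1 else 0) (rootedMatrix c ρ F).adjugate

lemma kernelVector_map {E' : Type*} [CommRing E'] (f : E →+* E') (F : Matrix (Fin r) (Fin r) E)
    (a : Fin r) : f (kernelVector c ρ F a) = kernelVector c ρ (F.map f) a := by
  have h : (rootedMatrix c ρ (F.map f)).adjugate = (rootedMatrix c ρ F).adjugate.map f := by
    rw [← rootedMatrix_map]
    exact (RingHom.map_adjugate f _).symm
  rw [kernelVector, kernelVector, h]
  simp only [Matrix.vecMul, dotProduct, map_sum, map_mul, Matrix.map_apply]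
  refine Finset.sum_congr rfl fun b _ => ?_
  split_ifs <;> simp

lemma vecMul_rootedMatrix (x : Fin r → E) (F : Matrix (Fin r) (Fin r) E) (b : Fin r) :
    Matrix.vecMul x (rootedMatrix c ρ F) b =
      if ρ (c b) = b then x b else ∑ a, x a * F a b := by
  simp only [Matrix.vecMul, dotProduct, rootedMatrix, Matrix.of_apply]
  split_ifs with h
  · simp
  · rfl

lemma kernelVector_vecMul (F : Matrix (Fin r) (Fin r) E) (b : Fin r) :
    Matrix.vecMul (kernelVector c ρ F) (rootedMatrix c ρ F) b =
      if ρ (c b) = b then (rootedMatrix c ρ F).det else 0 := by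
  rw [kernelVector, Matrix.vecMul_vecMul, Matrix.adjugate_mul, Matrix.vecMul_smul, Matrix.vecMul_one]
  simp

lemma kernelVector_root (hρ : ∀ j, c (ρ j) = j) (F : Matrix (Fin r) (Fin r) E) (j : β) :
    kernelVector c ρ F (ρ j) = (rootedMatrix c ρ F).det := by
  have h := kernelVector_vecMul c ρ F (ρ j)
  rw [vecMul_rootedMatrix] at h
  simpa [hρ] using h

/-- At the non-root columns this is the adjugate identity. A root column is minus the sum of the
other columns of its block, because the row sums vanish. -/
lemma sum_kernelVector_mul (F : Matrix (Fin r) (Fin r) E)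
    (hF : ∀ a b, c a ≠ c b → F a b = 0) (hrow : ∀ a, ∑ b, F a b = 0) (b : Fin r) :
    ∑ a, kernelVector c ρ F a * F a b = 0 := by
  classical
  have h1 (b) (hb : ρ (c b) ≠ b) : ∑ a, kernelVector c ρ F a * F a b = 0 := by
    have h := kernelVector_vecMul c ρ F b
    rw [vecMul_rootedMatrix] at h
    simpa [hb] using h
  by_cases hb : ρ (c b) = b
  · have h2 : ∑ b' with c b' = c b, ∑ a, kernelVector c ρ F a * F a b' = 0 := by
      rw [Finset.sum_comm]
      refine Finset.sum_eq_zero fun a _ => ?_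
      rw [← Finset.mul_sum]
      by_cases ha : c a = c b
      · have : ∑ b' with c b' = c b, F a b' = ∑ b', F a b' := by
          rw [Finset.sum_filter]
          refine Finset.sum_congr rfl fun b' _ => ?_
          split_ifs with h
          · rfl
          · exact (hF a b' (by rw [ha]; exact Ne.symm h)).symm
        rw [this, hrow, mul_zero]
      · rw [Finset.sum_eq_zero, mul_zero]
        intro b' hb'
        refine hF a b' ?_
        rw [(Finset.mem_filter.mp hb').2]
        exact ha
    rw [Finset.sum_eq_single b] at h2
    · exact h2
    · intro b' hb' hne
      apply h1
      rw [(Finset.mem_filter.mp hb').2, hb]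
      exact Ne.symm hne
    · simp
  · exact h1 b hb

/-- Uniqueness of the left kernel vector normalized at the roots: multiply the rooted system by the
adjugate. No invertibility is needed. -/
lemma det_mul_eq_kernelVector (F : Matrix (Fin r) (Fin r) E) (x : Fin r → E)
    (hx : ∀ b, ∑ a, x a * F a b = 0) (hx1 : ∀ j, x (ρ j) = 1) (a : Fin r) :
    (rootedMatrix c ρ F).det * x a = kernelVector c ρ F a := by
  have h1 : Matrix.vecMul x (rootedMatrix c ρ F) = fun b => if ρ (c b) = b then 1 else 0 := by
    ext b
    rw [vecMul_rootedMatrix]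
    split_ifs with h
    · rw [← h, hx1]
    · exact hx b
  rw [kernelVector, ← h1, Matrix.vecMul_vecMul, Matrix.mul_adjugate, Matrix.vecMul_smul,
    Matrix.vecMul_one]
  rfl

lemma associated_det_rootedMatrix (u : Fin r → E) (hu : ∀ a, IsUnit (u a))
    (F : Matrix (Fin r) (Fin r) E) :
    Associated (rootedMatrix c ρ (Matrix.of fun a b => u a * F a b)).det
      (rootedMatrix c ρ F).det := by
  classical
  -- Scaling rows also scales the unit entries in the root columns; the diagonal factor on the
  -- left-hand side corrects for this.
  have h : rootedMatrix c ρ (Matrix.of fun a b => u a * F a b) *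
      Matrix.diagonal (fun b => if ρ (c b) = b then u b else 1) =
      Matrix.diagonal u * rootedMatrix c ρ F := by
    ext a b
    rw [Matrix.mul_diagonal, Matrix.diagonal_mul]
    simp only [rootedMatrix, Matrix.of_apply]
    split_ifs with h1 h2
    · rw [h2, _root_.one_mul, _root_.mul_one]
    · simp
    · simp
  have h2 := congrArg Matrix.det h
  rw [Matrix.det_mul, Matrix.det_mul, Matrix.det_diagonal, Matrix.det_diagonal] at h2
  have hu1 : IsUnit (∏ a, u a) := IsUnit.prod_univ_iff.mpr hu
  have hu2 : IsUnit (∏ b, if ρ (c b) = b then u b else 1) :=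
    IsUnit.prod_univ_iff.mpr fun b => by split_ifs; exacts [hu b, isUnit_one]
  obtain ⟨v1, hv1⟩ := hu1
  obtain ⟨v2, hv2⟩ := hu2
  refine ⟨v2 * v1⁻¹, ?_⟩
  rw [Units.val_mul, ← _root_.mul_assoc, hv2, h2, ← hv1, mul_comm (v1 : E), _root_.mul_assoc,
    Units.mul_inv, _root_.mul_one]

end Matrix

section
variable {N : Type} [AddCommGroup N] {S : Over SpecC}

lemma isUnit_pullT_chi (f : S ⟶ Torus N) (n : N) : IsUnit (pullT f (chi n)) :=
  ⟨(charUnits f n).toMul, charUnits_apply f n⟩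

end

/-! ### The torus as seen from one complete intersection -/

namespace ToricCI

variable {M : Type} [AddCommGroup M] {r : ℕ}

open scoped Classical in
/-- One of the two presentations of the torus `N` of the total space of a toric complete
intersection, together with the block decomposition of the matrix `(W)`. -/
structure Presentation (C : ToricCI M r) (N : Type) [AddCommGroup N] (β : Type) where
  iso : CharX M r ≃+ N
  τ : Equiv.Perm (Fin r)
  c : Fin r → β
  ρ : β → Fin r
  c_ρ : ∀ j, c (ρ j) = j
  ω : N →+ (β → ℤ)
  ω_inl : ∀ m, ω (iso (m, 0)) = 0
  ω_single : ∀ k, ω (iso (0, Pi.single (τ k) 1)) = Pi.single (c k) 1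
  F : Matrix (Fin r) (Fin r) (AddMonoidAlgebra ℂ M)
  F_block : ∀ a b, c a ≠ c b → F a b = 0
  F_row : ∀ a, ∑ b, F a b = C.coord (τ a)

namespace Presentation

variable {C : ToricCI M r} {N β : Type} [AddCommGroup N] (P : Presentation C N β)
  {S : Over SpecC}

/-- The inclusion of the characters pulled back from `Y`. -/
def incl : M →+ N := (P.iso : CharX M r →+ N).comp (AddMonoidHom.inl M (Fin r → ℤ))

/-- The characters given by the fibre coordinates. -/
def u (k : Fin r) : N := P.iso (0, Pi.single (P.τ k) 1)

/-- The matrix `(W)`. -/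
def W : Matrix (Fin r) (Fin r) (AddMonoidAlgebra ℂ N) :=
  Matrix.of fun a b => chi (P.u a) * AddMonoidAlgebra.mapDomainRingHom ℂ P.incl (P.F a b)

/-- The determinant of the rooted matrix of coordinates. -/
def d : AddMonoidAlgebra ℂ M := (rootedMatrix P.c P.ρ P.F).det

/-- The cofactors spanning the left kernel. -/
def y : Fin r → AddMonoidAlgebra ℂ M := kernelVector P.c P.ρ P.F

/-- The function on the torus of `Y` whose non-vanishing locus on `Z` is the image of the rank
locus. -/
def q : AddMonoidAlgebra ℂ M := P.d * ∏ a, P.y a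

/-- The projection of the torus to `Y`. -/
def proj : Torus N ⟶ C.Y.V := torusHom P.incl ≫ C.Y.emb

lemma pullT_W (f : S ⟶ Torus N) (a b : Fin r) :
    pullT f (P.W a b) = pullT f (chi (P.u a)) * pullT (f ≫ torusHom P.incl) (P.F a b) := by
  rw [pullT_torusHom, W, Matrix.of_apply, map_mul]
  rfl

lemma sum_row_pullT_W (f : S ⟶ Torus N) (a : Fin r) :
    ∑ b, pullT f (P.W a b) =
      pullT f (chi (P.u a)) * pullT (f ≫ torusHom P.incl) (C.coord (P.τ a)) := by
  simp only [pullT_W]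
  rw [← Finset.mul_sum, ← map_sum, P.F_row]

/-- The characters from `Y` and the fibre coordinates generate `N`. -/
lemma charUnits_ext {f g : S ⟶ Torus N} (h : f ≫ torusHom P.incl = g ≫ torusHom P.incl)
    (h' : ∀ k, pullT f (chi (P.u k)) = pullT g (chi (P.u k))) : f = g := by
  have h1 : (charUnits f).comp (P.iso : CharX M r →+ N) =
      (charUnits g).comp (P.iso : CharX M r →+ N) := by
    apply AddMonoidHom.ext
    rintro ⟨m, v⟩
    have hm : charUnits f (P.iso (m, 0)) = charUnits g (P.iso (m, 0)) := by
      have := congrArg charUnits h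
      rw [charUnits_torusHom, charUnits_torusHom] at this
      exact congr($this m)
    have hk (k : Fin r) : charUnits f (P.iso (0, Pi.single k 1)) =
        charUnits g (P.iso (0, Pi.single k 1)) := by
      obtain ⟨k, rfl⟩ := P.τ.surjective k
      exact Additive.toMul.injective (Units.ext (h' k))
    have hx : ((m, v) : CharX M r) = (m, 0) + ∑ k, v k • (0, Pi.single k 1) := by
      ext
      · simp [Prod.fst_sum]
      · simp [Prod.snd_sum, Finset.sum_apply, Pi.single_apply]
    simp only [AddMonoidHom.comp_apply, AddMonoidHom.coe_coe]
    rw [hx, map_add, map_add, map_add, map_sum, map_sum, map_sum, hm]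
    simp only [map_zsmul, hk]
  apply charUnits_injective
  ext n
  obtain ⟨x, rfl⟩ := P.iso.surjective n
  exact congr((($h1 x).toMul : Γ(S.left, ⊤)))

/-- `N` is the direct sum of the characters from `Y` and the free group on the fibre coordinates, so
both parts can be prescribed independently. -/
lemma exists_slice (O : S ⟶ Torus M) (v : Fin r → Γ(S.left, ⊤)ˣ) :
    ∃ s : S ⟶ Torus N, s ≫ torusHom P.incl = O ∧ ∀ k, pullT s (chi (P.u k)) = v k := by
  let φ : (Fin r → ℤ) →+ Additive Γ(S.left, ⊤)ˣ :=
    { toFun := fun x => ∑ k, x (P.τ k) • Additive.ofMul (v k)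
      map_zero' := by simp
      map_add' := fun x x' => by
        simp only [Pi.add_apply, add_zsmul, Finset.sum_add_distrib] }
  obtain ⟨s, hs⟩ := exists_charUnits_eq
    (((charUnits O).coprod φ).comp (P.iso.symm : N →+ CharX M r))
  refine ⟨s, ?_, fun k => ?_⟩
  · apply charUnits_injective
    rw [charUnits_torusHom, hs]
    ext m
    simp [incl]
  · rw [← charUnits_apply, hs]
    simp only [u, AddMonoidHom.comp_apply, AddMonoidHom.coe_coe, AddEquiv.symm_apply_apply,
      AddMonoidHom.coprod_apply, map_zero, zero_add]
    have : φ (Pi.single (P.τ k) 1) = Additive.ofMul (v k) := by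
      simp [φ, Pi.single_apply]
    rw [this]
    rfl

/-- Fibre coordinates divided by the root coordinate of their block form a left kernel vector of `F`
with value `1` at the roots, so uniqueness compares them with the cofactors. -/
lemma pullT_y_mul (f : S ⟶ Torus N)
    (hcol : ∀ b, ∑ a, pullT f (P.W a b) = 0) (a : Fin r) :
    pullT (f ≫ torusHom P.incl) (P.y a) * pullT f (chi (P.u (P.ρ (P.c a)))) =
      pullT (f ≫ torusHom P.incl) P.d * pullT f (chi (P.u a)) := by
  choose v hv using fun a => isUnit_pullT_chi f (P.u a)
  have hF (a b) (h : P.c a ≠ P.c b) : pullT (f ≫ torusHom P.incl) (P.F a b) = 0 := by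
    rw [P.F_block a b h, map_zero]
  have h := det_mul_eq_kernelVector P.c P.ρ (P.F.map (pullT (f ≫ torusHom P.incl)))
    (fun a => (v a : Γ(S.left, ⊤)) * ((v (P.ρ (P.c a)))⁻¹ : _ˣ)) (fun b => ?_) (fun j => ?_) a
  · have hd : pullT (f ≫ torusHom P.incl) P.d =
        (rootedMatrix P.c P.ρ (P.F.map (pullT (f ≫ torusHom P.incl)))).det := by
      rw [d, RingHom.map_det, RingHom.mapMatrix_apply, rootedMatrix_map]
    rw [← hv, ← hv, hd, y, kernelVector_map, ← h, _root_.mul_assoc, _root_.mul_assoc,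
      Units.inv_mul, _root_.mul_one]
  -- The root of the block of `a` may be exchanged for that of `b`, since entries off the blocks are
  -- zero. The common factor then leaves the sum.
  · have h1 (a) : (v a : Γ(S.left, ⊤)) * ((v (P.ρ (P.c a)))⁻¹ : _ˣ) *
        P.F.map (pullT (f ≫ torusHom P.incl)) a b =
        ((v (P.ρ (P.c b)))⁻¹ : _ˣ) * pullT f (P.W a b) := by
      rw [pullT_W, ← hv, Matrix.map_apply]
      by_cases h : P.c a = P.c b
      · rw [h]; ring
      · rw [hF a b h]; simp
    simp_rw [h1]
    rw [← Finset.mul_sum, hcol, mul_zero]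
  · rw [P.c_ρ, Units.mul_inv]

lemma pullT_y_root (O : S ⟶ Torus M) (j : β) : pullT O (P.y (P.ρ j)) = pullT O P.d := by
  rw [y, d, kernelVector_root _ _ P.c_ρ]

lemma sum_y_mul (O : S ⟶ Torus M) (hO : ∀ k, pullT O (C.coord k) = 0) (b : Fin r) :
    ∑ a, pullT O (P.y a) * pullT O (P.F a b) = 0 := by
  have := sum_kernelVector_mul P.c P.ρ (P.F.map (pullT O)) (fun a b h => by
    rw [Matrix.map_apply, P.F_block a b h, map_zero]) (fun a => by
    simp only [Matrix.map_apply]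
    rw [← map_sum, P.F_row, hO]) b
  simpa only [y, kernelVector_map, Matrix.map_apply] using this

/-! ### The rank locus -/

/-- `R` is the locus in the torus on which the row and column sums of `(W)` vanish and the
determinant of the rooted matrix does not. -/
structure IsRankLocus (I : (Torus N).left.IdealSheafData) (R : I.subscheme.Opens) : Prop where
  le_ker_iff : ∀ {S : Over SpecC} (f : S ⟶ Torus N), I ≤ f.left.ker ↔
    (∀ a, ∑ b, pullT f (P.W a b) = 0) ∧ ∀ b, ∑ a, pullT f (P.W a b) = 0
  mem_iff : ∀ x : I.subscheme, x ∈ R ↔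
    AddMonoidAlgebra.mapDomainRingHom ℂ P.incl P.d ∉ PrimeSpectrum.asIdeal (I.subschemeι x)

section RankLocus

variable {P} {I : (Torus N).left.IdealSheafData} {R : I.subscheme.Opens}
  (hR : P.IsRankLocus I R)
include hR

lemma IsRankLocus.exists_lift (f : S ⟶ Torus N)
    (hO : ∀ k, pullT (f ≫ torusHom P.incl) (C.coord k) = 0)
    (hcol : ∀ b, ∑ a, pullT f (P.W a b) = 0)
    (hd : IsUnit (pullT (f ≫ torusHom P.incl) P.d)) :
    ∃ g : S ⟶ subObj I R, g ≫ subIncl I R = f := by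
  have hI : I ≤ f.left.ker := (hR.le_ker_iff f).mpr
    ⟨fun a => by rw [sum_row_pullT_W, hO, mul_zero], hcol⟩
  refine exists_comp_subIncl_eq f hI fun s => ?_
  obtain ⟨u, hu⟩ := exists_subschemeι_eq f hI s
  refine ⟨u, (hR.mem_iff u).mpr ?_, hu⟩
  rw [hu]
  rw [pullT_torusHom] at hd
  exact notMem_asIdeal_of_isUnit (R := .of (AddMonoidAlgebra ℂ N)) f.left hd s

lemma IsRankLocus.sum_col (g : S ⟶ subObj I R) (b : Fin r) :
    ∑ a, pullT (g ≫ subIncl I R) (P.W a b) = 0 :=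
  ((hR.le_ker_iff _).mp (le_ker_comp_subIncl g)).2 b

lemma IsRankLocus.coord_eq_zero (g : S ⟶ subObj I R) (k : Fin r) :
    pullT ((g ≫ subIncl I R) ≫ torusHom P.incl) (C.coord k) = 0 := by
  obtain ⟨k, rfl⟩ := P.τ.surjective k
  have h := ((hR.le_ker_iff _).mp (le_ker_comp_subIncl g)).1 k
  rw [sum_row_pullT_W] at h
  exact (isUnit_pullT_chi (g ≫ subIncl I R) (P.u k)).mul_right_eq_zero.mp h

lemma IsRankLocus.isUnit_d (g : S ⟶ subObj I R) :
    IsUnit (pullT ((g ≫ subIncl I R) ≫ torusHom P.incl) P.d) := by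
  rw [pullT_torusHom]
  refine isUnit_of_notMem_asIdeal (R := .of (AddMonoidAlgebra ℂ N)) (g ≫ subIncl I R).left
    fun s => ?_
  obtain ⟨u, hu, hus⟩ := exists_mem_subIncl g s
  exact (congrArg (fun t : (Torus N).left =>
    AddMonoidAlgebra.mapDomainRingHom ℂ P.incl P.d ∉ PrimeSpectrum.asIdeal t) hus).mp
      ((hR.mem_iff u).mp hu)

/-- On the rank locus `y_a` is `d` times a quotient of fibre coordinates, hence invertible. This is
why the image lies in `Ω`. -/
lemma IsRankLocus.isUnit_q (g : S ⟶ subObj I R) :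
    IsUnit (pullT ((g ≫ subIncl I R) ≫ torusHom P.incl) P.q) := by
  rw [q, map_mul, map_prod]
  refine (hR.isUnit_d g).mul (IsUnit.prod_univ_iff.mpr fun a => ?_)
  refine isUnit_of_mul_isUnit_left
    (y := pullT (g ≫ subIncl I R) (chi (P.u (P.ρ (P.c a))))) ?_
  rw [P.pullT_y_mul _ (hR.sum_col g)]
  exact (hR.isUnit_d g).mul (isUnit_pullT_chi _ _)

end RankLocus

/-! ### The image of the rank locus -/

/-- The image of the rank locus in `Z`. -/
def Ω : C.idealZ.subscheme.Opens :=
  C.idealZ.subschemeι ⁻¹ᵁ (C.Y.emb.left ''ᵁ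
    (show (Torus M).left.Opens from
      PrimeSpectrum.basicOpen (R := AddMonoidAlgebra ℂ M) P.q))

lemma mem_Ω_iff (z : C.idealZ.subscheme) : z ∈ P.Ω ↔ ∃ t : (Torus M).left,
    P.q ∉ PrimeSpectrum.asIdeal t ∧ C.Y.emb.left t = C.idealZ.subschemeι z :=
  Iff.rfl

lemma exists_lift_Ω (O : S ⟶ Torus M) (hO : ∀ k, pullT O (C.coord k) = 0)
    (hq : IsUnit (pullT O P.q)) :
    ∃ g : S ⟶ subObj C.idealZ P.Ω, g ≫ subIncl C.idealZ P.Ω = O ≫ C.Y.emb := by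
  have hI := (C.idealZ_le_ker_iff O).mpr hO
  refine exists_comp_subIncl_eq _ hI fun s => ?_
  obtain ⟨u, hu⟩ := exists_subschemeι_eq _ hI s
  refine ⟨u, (P.mem_Ω_iff u).mpr ⟨O.left s, ?_, hu.symm⟩, hu⟩
  exact notMem_asIdeal_of_isUnit (R := .of (AddMonoidAlgebra ℂ M)) O.left hq s

/-- `Ω` lies in the torus of `Y`, so its inclusion has torus coordinates, in which the equations of
`Z` and the invertibility of `q` can be read off. -/
lemma exists_torus_lift_Ω : ∃ O : subObj C.idealZ P.Ω ⟶ Torus M,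
    O ≫ C.Y.emb = subIncl C.idealZ P.Ω ∧ (∀ k, pullT O (C.coord k) = 0) ∧
    IsUnit (pullT O P.q) := by
  have hr : Set.range (subIncl C.idealZ P.Ω).left ⊆ Set.range C.Y.emb.left := by
    rintro _ ⟨z, rfl⟩
    obtain ⟨t, _, ht⟩ := (P.mem_Ω_iff _).mp z.2
    exact ⟨t, ht⟩
  let O' := IsOpenImmersion.lift C.Y.emb.left (subIncl C.idealZ P.Ω).left hr
  have hO' : O' ≫ C.Y.emb.left = (subIncl C.idealZ P.Ω).left :=
    IsOpenImmersion.lift_fac _ _ _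
  let O : subObj C.idealZ P.Ω ⟶ Torus M := Over.homMk O' (by
    rw [← Over.w C.Y.emb, ← Category.assoc, hO', Over.w])
  have hO : O ≫ C.Y.emb = subIncl C.idealZ P.Ω := by
    ext1
    exact hO'
  refine ⟨O, hO, ?_, ?_⟩
  · rw [← C.idealZ_le_ker_iff, hO]
    simpa using le_ker_comp_subIncl (𝟙 (subObj C.idealZ P.Ω))
  · refine isUnit_of_notMem_asIdeal (R := .of (AddMonoidAlgebra ℂ M)) O.left fun z => ?_
    obtain ⟨t, ht, htz⟩ := (P.mem_Ω_iff _).mp z.2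
    have h1 : C.Y.emb.left (O.left z) = C.Y.emb.left t :=
      (congr(($hO).left z)).trans htz.symm
    have h2 : O.left z = t := C.Y.emb.left.isOpenEmbedding.injective h1
    exact (congrArg (fun t : (Torus M).left => P.q ∉ PrimeSpectrum.asIdeal t) h2).mpr ht

end Presentation

end ToricCI

namespace ToricCI

variable {M : Type} [AddCommGroup M] {r : ℕ}

namespace Presentation

variable {C : ToricCI M r} {N β : Type} [AddCommGroup N] (P : Presentation C N β)
  {S : Over SpecC}

/-! ### The torsor structure -/

lemma ω_incl (m : M) : P.ω (P.incl m) = 0 := P.ω_inl m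

open scoped Classical in
lemma ω_u (k : Fin r) : P.ω (P.u k) = Pi.single (P.c k) 1 := P.ω_single k

/-- Characters from `Y` have weight zero, so the action preserves the fibres of the projection. -/
lemma torus_mul_comp_incl (t : S ⟶ Torus (β → ℤ)) (s : S ⟶ Torus N) :
    (lift (t ≫ torusHom P.ω) s ≫ μ[Torus N]) ≫ torusHom P.incl = s ≫ torusHom P.incl := by
  apply charUnits_injective
  rw [charUnits_torusHom, charUnits_torusHom, charUnits_mul, charUnits_torusHom]
  ext m
  simp [ω_incl]

/-- The characters of the torus `T` given by the fibre coordinates of chosen indices in the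
blocks. -/
def κ [Fintype β] : (β → ℤ) →+ N where
  toFun v := ∑ j, v j • P.u (P.ρ j)
  map_zero' := by simp
  map_add' v w := by simp only [Pi.add_apply, add_zsmul, Finset.sum_add_distrib]

open scoped Classical in
-- Reading off the root coordinates recovers an element of `𝔾_m^β` from its image in the torus.
lemma ω_κ [Fintype β] (v : β → ℤ) : P.ω (P.κ v) = v := by
  change P.ω (∑ j, v j • P.u (P.ρ j)) = v
  rw [map_sum]
  simp only [map_zsmul, ω_u, P.c_ρ]
  ext j
  simp [Finset.sum_apply, Pi.single_apply]

open scoped Classical in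
lemma κ_single [Fintype β] (j : β) : P.κ (Pi.single j 1) = P.u (P.ρ j) := by
  change ∑ i, (Pi.single j 1 : β → ℤ) i • P.u (P.ρ i) = _
  rw [Finset.sum_eq_single j] <;> simp +contextual

variable {P} {I : (Torus N).left.IdealSheafData} {R : I.subscheme.Opens}

variable (P) in
/-- A slice of the projection from the rank locus to its image. -/
lemma exists_kernel_slice (O : S ⟶ Torus M)
    (hO : ∀ k, pullT O (C.coord k) = 0) (hq : IsUnit (pullT O P.q)) :
    ∃ s : S ⟶ Torus N, s ≫ torusHom P.incl = O ∧
      (∀ a, pullT O P.d * pullT s (chi (P.u a)) = pullT O (P.y a)) ∧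
      ∀ b, ∑ a, pullT s (P.W a b) = 0 := by
  have hq' := hq
  rw [q, map_mul, map_prod, IsUnit.mul_iff, IsUnit.prod_univ_iff] at hq'
  obtain ⟨⟨d, hd⟩, hy⟩ := hq'
  choose y hy using hy
  -- The fibre coordinates are `y_a / d`, which makes every root coordinate `1`.
  obtain ⟨s, hs, hs'⟩ := P.exists_slice O (fun a => d⁻¹ * y a)
  have h1 (a) : pullT O P.d * pullT s (chi (P.u a)) = pullT O (P.y a) := by
    rw [← hd, hs', ← hy, Units.val_mul, Units.mul_inv_cancel_left]
  refine ⟨s, hs, h1, fun b => ?_⟩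
  have h2 : pullT O P.d * ∑ a, pullT s (P.W a b) = 0 := by
    rw [Finset.mul_sum]
    simp only [pullT_W, ← _root_.mul_assoc, h1, hs]
    exact P.sum_y_mul O hO b
  rw [← hd] at h2
  exact d.isUnit.mul_right_eq_zero.mp h2

lemma pullT_mul_chi_u (t : S ⟶ Torus (β → ℤ)) (s : S ⟶ Torus N) (k : Fin r) [DecidableEq β] :
    pullT (lift (t ≫ torusHom P.ω) s ≫ μ[Torus N]) (chi (P.u k)) =
      pullT t (chi (Pi.single (P.c k) 1)) * pullT s (chi (P.u k)) := by
  rw [pullT_mul_chi, pullT_torusHom_single, ω_u]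
  congr!

/-- All non-zero entries of a column lie in one block and are rescaled by the same factor. -/
lemma sum_col_mul (t : S ⟶ Torus (β → ℤ)) (s : S ⟶ Torus N)
    (hcol : ∀ b, ∑ a, pullT s (P.W a b) = 0) (b : Fin r) :
    ∑ a, pullT (lift (t ≫ torusHom P.ω) s ≫ μ[Torus N]) (P.W a b) = 0 := by
  classical
  have h1 (a) : pullT (lift (t ≫ torusHom P.ω) s ≫ μ[Torus N]) (P.W a b) =
      pullT t (chi (Pi.single (P.c b) 1)) * pullT s (P.W a b) := by
    rw [pullT_W, pullT_mul_chi_u, torus_mul_comp_incl, _root_.mul_assoc, ← pullT_W]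
    by_cases h : P.c a = P.c b
    · rw [h]
    · rw [pullT_W, P.F_block a b h, map_zero]; ring
  simp only [h1]
  rw [← Finset.mul_sum, hcol, mul_zero]

lemma IsRankLocus.exists_lift_mul (hR : P.IsRankLocus I R) (t : S ⟶ Torus (β → ℤ))
    (s : S ⟶ Torus N)
    (hO : ∀ k, pullT (s ≫ torusHom P.incl) (C.coord k) = 0)
    (hcol : ∀ b, ∑ a, pullT s (P.W a b) = 0)
    (hd : IsUnit (pullT (s ≫ torusHom P.incl) P.d)) :
    ∃ g : S ⟶ subObj I R, g ≫ subIncl I R = lift (t ≫ torusHom P.ω) s ≫ μ[Torus N] := by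
  apply hR.exists_lift
  · rwa [torus_mul_comp_incl]
  · exact sum_col_mul t s hcol
  · rwa [torus_mul_comp_incl]

/-- The trivialization is `(t, z) ↦ t · s(z)`, with `s` the cofactor slice. Its inverse records the
root coordinates and the projection. -/
theorem IsRankLocus.exists_isTrivialTorsor [Fintype β] (hR : P.IsRankLocus I R)
    [ModObj (Torus (β → ℤ)) (subObj I R)]
    (hact : γ[Torus (β → ℤ), subObj I R] ≫ subIncl I R =
      (torusHom P.ω ⊗ₘ subIncl I R) ≫ μ[Torus N]) :
    (∀ z, z ∈ P.Ω ↔ ∃ x ∈ R, P.proj.left (I.subschemeι x) = C.idealZ.subschemeι z) ∧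
    ∃ π : subObj I R ⟶ subObj C.idealZ P.Ω,
      π ≫ subIncl C.idealZ P.Ω = subIncl I R ≫ P.proj ∧
      IsTrivialTorsor (Torus (β → ℤ)) π := by
  classical
  -- the projection
  have hid : 𝟙 (subObj I R) ≫ subIncl I R = subIncl I R := Category.id_comp _
  have c1 := hR.coord_eq_zero (𝟙 (subObj I R))
  have d1 := hR.isUnit_d (𝟙 (subObj I R))
  have q1 := hR.isUnit_q (𝟙 (subObj I R))
  have col1 := hR.sum_col (𝟙 (subObj I R))
  rw [hid] at c1 d1 q1
  simp only [hid] at col1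
  obtain ⟨π, hπ⟩ := P.exists_lift_Ω (subIncl I R ≫ torusHom P.incl) c1 q1
  have hπ' : π ≫ subIncl C.idealZ P.Ω = subIncl I R ≫ P.proj := by
    rw [hπ, Category.assoc]; rfl
  -- the slice
  obtain ⟨O, hO, hOc, hOq⟩ := P.exists_torus_lift_Ω
  obtain ⟨s, hs, hsy, hsc⟩ := P.exists_kernel_slice O hOc hOq
  have hOd : IsUnit (pullT O P.d) := by
    rw [q, map_mul] at hOq
    exact isUnit_of_mul_isUnit_left hOq
  have hπO : π ≫ O = subIncl I R ≫ torusHom P.incl := by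
    have : Mono C.Y.emb.left := inferInstance
    have : Mono C.Y.emb := Over.mono_of_mono_left _
    rw [← cancel_mono C.Y.emb, Category.assoc, hO, hπ]
  -- the trivialization
  let G := Torus (β → ℤ)
  let B := subObj C.idealZ P.Ω
  obtain ⟨ψ, hψ⟩ := hR.exists_lift_mul (fst G B) (snd G B ≫ s)
    (fun k => by rw [Category.assoc, hs, pullT_comp_apply, hOc, map_zero])
    (fun b => by
      simp only [pullT_comp_apply]
      rw [← map_sum, hsc, map_zero])
    (by
      rw [Category.assoc, hs, pullT_comp_apply]
      exact hOd.map _)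
  have hψπ : ψ ≫ π = snd G B := by
    rw [← cancel_mono (subIncl C.idealZ P.Ω), Category.assoc, hπ, ← Category.assoc,
      ← Category.assoc, hψ, torus_mul_comp_incl, Category.assoc (snd G B), hs, Category.assoc, hO]
  let χ : subObj I R ⟶ G := subIncl I R ≫ torusHom P.κ
  have hsroot (j : β) : pullT s (chi (P.u (P.ρ j))) = 1 := by
    have h := hsy (P.ρ j)
    rw [pullT_y_root] at h
    exact hOd.mul_left_cancel (h.trans (_root_.mul_one _).symm)
  have hψχ : ψ ≫ χ = fst G B := by
    apply charUnits_injective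
    rw [← Category.assoc, hψ, charUnits_torusHom, charUnits_mul, charUnits_torusHom, charUnits_comp]
    apply AddMonoidHom.ext
    intro v
    have h1 : charUnits s (P.κ v) = 0 := by
      change charUnits s (∑ j, v j • P.u (P.ρ j)) = 0
      rw [map_sum]
      refine Finset.sum_eq_zero fun j _ => ?_
      rw [map_zsmul]
      have : charUnits s (P.u (P.ρ j)) = 0 := Additive.toMul.injective (Units.ext (hsroot j))
      rw [this, smul_zero]
    simp only [AddMonoidHom.comp_apply, AddMonoidHom.add_apply, h1, map_zero, add_zero, ω_κ]
  -- A point of the rank locus is determined by its projection and its root coordinates: the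
  -- relation `y_a u_root = d u_a` yields the other coordinates, as `d` is invertible.
  have hinv : lift χ π ≫ ψ = 𝟙 _ := by
    rw [← cancel_mono (subIncl I R), Category.assoc, hψ, Category.id_comp, ← Category.assoc,
      comp_lift, ← Category.assoc, lift_fst, ← Category.assoc, lift_snd]
    apply P.charUnits_ext
    · rw [torus_mul_comp_incl, Category.assoc, hs, hπO]
    · intro k
      rw [pullT_mul_chi_u, pullT_torusHom_single, κ_single]
      have h1 : pullT (π ≫ O) P.d * pullT (π ≫ s) (chi (P.u k)) = pullT (π ≫ O) (P.y k) := by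
        rw [pullT_comp_apply, pullT_comp_apply, pullT_comp_apply, ← map_mul, hsy]
      rw [hπO] at h1
      apply d1.mul_left_cancel
      rw [← P.pullT_y_mul _ col1, ← h1]
      ring
  have hψe : (G ◁ ψ) ≫ γ[G, subObj I R] = (α_ G G B).inv ≫ (μ[G] ▷ B) ≫ ψ := by
    rw [← cancel_mono (subIncl I R), Category.assoc, hact, Category.assoc, Category.assoc, hψ]
    have h1 : (G ◁ ψ) ≫ (torusHom P.ω ⊗ₘ subIncl I R) =
        lift (fst G (G ⊗ B) ≫ torusHom P.ω) (snd G (G ⊗ B) ≫ ψ ≫ subIncl I R) := by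
      ext1 <;> simp
    have h2 : (α_ G G B).inv ≫ (μ[G] ▷ B) ≫ lift (fst G B ≫ torusHom P.ω) (snd G B ≫ s) =
        lift ((lift (fst G (G ⊗ B)) (snd G (G ⊗ B) ≫ fst G B) ≫ μ[G]) ≫ torusHom P.ω)
          (snd G (G ⊗ B) ≫ snd G B ≫ s) := by
      have h3 : (α_ G G B).inv ≫ fst (G ⊗ G) B =
          lift (fst G (G ⊗ B)) (snd G (G ⊗ B) ≫ fst G B) := by
        ext1 <;> simp
      ext1
      · simp only [Category.assoc, lift_fst, whiskerRight_fst_assoc]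
        rw [← Category.assoc, h3]
      · simp
    have h4 := congr($h2 ≫ μ[Torus N])
    rw [Category.assoc, Category.assoc] at h4
    rw [h4, ← Category.assoc, h1, hψ]
    apply charUnits_injective
    have e1 := charUnits_mul (fst G (G ⊗ B) ≫ torusHom P.ω)
      (snd G (G ⊗ B) ≫ lift (fst G B ≫ torusHom P.ω) (snd G B ≫ s) ≫ μ[Torus N])
    have e2 : snd G (G ⊗ B) ≫ lift (fst G B ≫ torusHom P.ω) (snd G B ≫ s) ≫ μ[Torus N] =
        lift ((snd G (G ⊗ B) ≫ fst G B) ≫ torusHom P.ω) (snd G (G ⊗ B) ≫ snd G B ≫ s) ≫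
          μ[Torus N] := by
      rw [← Category.assoc, comp_lift, Category.assoc]
    have e3 := charUnits_mul (fst G (G ⊗ B)) (snd G (G ⊗ B) ≫ fst G B)
    refine e1.trans ?_
    rw [e2, charUnits_mul, charUnits_mul, charUnits_torusHom, charUnits_torusHom,
      charUnits_torusHom]
    refine Eq.trans ?_ (congrArg (fun φ => φ.comp P.ω +
      charUnits (snd G (G ⊗ B) ≫ snd G B ≫ s)) e3.symm)
    ext n
    simp [add_assoc]
  refine ⟨fun z => ⟨fun hz => ?_, ?_⟩, π, hπ', ⟨ψ, lift χ π, ?_, hinv⟩, hψπ, hψe⟩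
  -- The section at the unit of `𝔾_m^β` shows that every point of `Ω` is attained.
  · let σ : B ⟶ subObj I R := lift (toUnit B ≫ η[G]) (𝟙 B) ≫ ψ
    have hσ : σ ≫ subIncl I R ≫ P.proj = subIncl C.idealZ P.Ω := by
      rw [← hπ', ← Category.assoc, Category.assoc _ ψ, hψπ, lift_snd, Category.id_comp]
    exact ⟨R.ι (σ.left ⟨z, hz⟩), (σ.left ⟨z, hz⟩).2, congr(($hσ).left ⟨z, hz⟩)⟩
  · rintro ⟨x, hx, hxz⟩
    have h1 : C.idealZ.subschemeι (P.Ω.ι (π.left ⟨x, hx⟩)) = P.proj.left (I.subschemeι x) :=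
      congr(($hπ').left ⟨x, hx⟩)
    have h2 : P.Ω.ι (π.left ⟨x, hx⟩) = z :=
      C.idealZ.subschemeι.injective (h1.trans hxz)
    rw [← h2]
    exact (π.left ⟨x, hx⟩).2
  · ext1
    · rw [Category.assoc, lift_fst, hψχ, Category.id_comp]
    · rw [Category.assoc, lift_snd, hψπ, Category.id_comp]

end Presentation

end ToricCI

/-! ### Actions and torsors -/

section Torsor

variable {G T R B B₁ B₂ : Over SpecC} [MonObj G]

/-- The action of `G` on a subobject `R` of a monoid `T` which is stable under multiplication by
the image of `G`. -/
abbrev modObjOfMono [MonObj T] (ω : G ⟶ T) (hη : η[G] ≫ ω = η[T]) (hμ : μ[G] ≫ ω = (ω ⊗ₘ ω) ≫ μ[T])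
    (i : R ⟶ T) [Mono i] (a : G ⊗ R ⟶ R) (ha : a ≫ i = (ω ⊗ₘ i) ≫ μ[T]) : ModObj G R where
  smul := a
  one_smul := by
    change η[G] ▷ R ≫ a = (λ_ R).hom
    rw [← cancel_mono i, Category.assoc, ha, ← Category.assoc]
    have h : (η[G] ▷ R) ≫ (ω ⊗ₘ i) = ((𝟙_ _) ◁ i) ≫ (η[T] ▷ T) := by
      rw [← tensorHom_id, tensorHom_comp_tensorHom, hη, Category.id_comp, ← id_tensorHom,
        ← tensorHom_id, tensorHom_comp_tensorHom, Category.id_comp, Category.comp_id]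
    rw [h, Category.assoc, MonObj.one_mul, leftUnitor_naturality]
  mul_smul := by
    change μ[G] ▷ R ≫ a = (α_ G G R).hom ≫ G ◁ a ≫ a
    rw [← cancel_mono i, Category.assoc, ha, Category.assoc, Category.assoc, ha]
    have h1 : (μ[G] ▷ R) ≫ (ω ⊗ₘ i) = ((ω ⊗ₘ ω) ⊗ₘ i) ≫ (μ[T] ▷ T) := by
      rw [← tensorHom_id, tensorHom_comp_tensorHom, hμ, ← tensorHom_id,
        tensorHom_comp_tensorHom]
      simp
    have h2 : (G ◁ a) ≫ (ω ⊗ₘ i) = (ω ⊗ₘ (ω ⊗ₘ i)) ≫ (T ◁ μ[T]) := by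
      rw [← id_tensorHom, tensorHom_comp_tensorHom, ha, ← id_tensorHom,
        tensorHom_comp_tensorHom]
      simp
    rw [reassoc_of% h1, reassoc_of% h2, MonObj.mul_assoc, associator_naturality_assoc]

variable [ModObj G R]

lemma IsTrivialTorsor.smul_comp {π : R ⟶ B} (h : IsTrivialTorsor G π) :
    γ[G, R] ≫ π = snd G R ≫ π := by
  obtain ⟨ψ, hψ, he⟩ := h
  rw [← cancel_epi (G ◁ ψ.hom), ← Category.assoc, he]
  simp [hψ]

/-- A trivial torsor is a split categorical quotient: an invariant morphism is recovered from its
values on the unit section. -/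
lemma IsTrivialTorsor.exists_section {π : R ⟶ B} (h : IsTrivialTorsor G π) :
    ∃ s : B ⟶ R, s ≫ π = 𝟙 B ∧
      ∀ {Z : Over SpecC} (f : R ⟶ Z), γ[G, R] ≫ f = snd G R ≫ f → π ≫ s ≫ f = f := by
  obtain ⟨ψ, hψ, he⟩ := h
  refine ⟨lift (toUnit B ≫ η[G]) (𝟙 B) ≫ ψ.hom, ?_, fun {Z} f hf => ?_⟩
  · rw [Category.assoc, hψ, lift_snd]
  · have h1 : ψ.hom ≫ f = snd G B ≫ (lift (toUnit B ≫ η[G]) (𝟙 B) ≫ ψ.hom) ≫ f := by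
      -- Equivariance evaluated at `(g, (1, b))`, which expresses `ψ (g, b)` as `g · ψ (1, b)`.
      have h2 := congr(lift (fst G B) (snd G B ≫ lift (toUnit B ≫ η[G]) (𝟙 B)) ≫ $he ≫ f)
      have h3 : lift (fst G B) (snd G B ≫ lift (toUnit B ≫ η[G]) (𝟙 B)) ≫
          (α_ G G B).inv ≫ (μ[G] ▷ B) = 𝟙 _ := by
        have h4 : lift (fst G B) (toUnit (G ⊗ B) ≫ η[G]) ≫ μ[G] = fst G B := by
          have h5 : lift (fst G B) (toUnit (G ⊗ B) ≫ η[G]) =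
              lift (fst G B) (toUnit _) ≫ (G ◁ η[G]) := by simp
          rw [h5, Category.assoc, MonObj.mul_one]
          simp
        have h6 : lift (fst G B) (snd G B ≫ lift (toUnit B ≫ η[G]) (𝟙 B)) ≫ (α_ G G B).inv =
            lift (lift (fst G B) (toUnit (G ⊗ B) ≫ η[G])) (snd G B) := by
          ext <;> simp
        rw [reassoc_of% h6, lift_whiskerRight, h4]
        simp
      simp only [Category.assoc] at h2
      rw [reassoc_of% h3, hf] at h2
      rw [← h2, ← Category.assoc, lift_whiskerLeft, lift_snd_assoc]
      simp only [Category.assoc]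
    rw [← cancel_epi ψ.hom, ← Category.assoc, hψ, h1]

/-- Each projection is invariant, so it factors through the other quotient; the sections show that
the factorizations are inverse to each other. -/
lemma IsTrivialTorsor.exists_iso {π₁ : R ⟶ B₁} {π₂ : R ⟶ B₂} (h₁ : IsTrivialTorsor G π₁)
    (h₂ : IsTrivialTorsor G π₂) : ∃ ε : B₁ ≅ B₂, π₁ ≫ ε.hom = π₂ := by
  obtain ⟨s₁, hs₁, hf₁⟩ := h₁.exists_section
  obtain ⟨s₂, hs₂, hf₂⟩ := h₂.exists_section
  refine ⟨⟨s₁ ≫ π₂, s₂ ≫ π₁, ?_, ?_⟩, hf₁ π₂ h₂.smul_comp⟩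
  · rw [Category.assoc, hf₂ π₁ h₁.smul_comp, hs₁]
  · rw [Category.assoc, hf₁ π₂ h₂.smul_comp, hs₂]

end Torsor

namespace ToricCI

/-! ### Characters of the superpotential -/

section Single

variable {M : Type} [AddCommGroup M] {r : ℕ} (A : ToricCI M r)

/-- Setting the fibre coordinates equal to `1` recovers the coordinate on `Y`. -/
lemma coord_eq_mapDomain (k : Fin r) : A.coord k =
    AddMonoidAlgebra.mapDomainRingHom ℂ (AddMonoidHom.fst M (Fin r → ℤ))
      (A.X.expand (A.Wpart k)) := by
  rw [expand_Wpart, map_mul]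
  have h1 : AddMonoidAlgebra.mapDomainRingHom ℂ (AddMonoidHom.fst M (Fin r → ℤ))
      (chi (0, Pi.single k 1)) = 1 := by
    simp [AddMonoidAlgebra.one_def]
  rw [h1, _root_.mul_one, ← RingHom.comp_apply, ← AddMonoidAlgebra.mapDomainRingHom_comp,
    AddMonoidHom.fst_comp_inl, AddMonoidAlgebra.mapDomainRingHom_id, RingHom.id_apply]

/-- `W_k` is linear in the `k`-th fibre coordinate and involves no other. Hence the sets `Lam k` are
disjoint. -/
lemma snd_eq_of_mem_Lam {k : Fin r} {χ : CharX M r} (h : χ ∈ A.Lam k) :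
    χ.2 = Pi.single k 1 := by
  rw [Lam, expand_Wpart, Finsupp.mem_support_iff, AddMonoidAlgebra.coeff_mul_single_apply,
    _root_.mul_one] at h
  obtain ⟨m, hm⟩ : χ + -(0, Pi.single k 1) ∈ Set.range (AddMonoidHom.inl M (Fin r → ℤ)) := by
    by_contra hne
    exact h (Finsupp.mapDomain_of_notMem_range _ _ hne)
  have h1 : (0 : Fin r → ℤ) = χ.2 + -Pi.single k 1 := congrArg Prod.snd hm
  exact (add_neg_eq_zero.mp h1.symm)

lemma Lam_disjoint {k k' : Fin r} {χ : CharX M r} (h : χ ∈ A.Lam k) (h' : χ ∈ A.Lam k') :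
    k = k' := by
  have h1 := (A.snd_eq_of_mem_Lam h).symm.trans (A.snd_eq_of_mem_Lam h')
  by_contra hne
  have := congrFun h1 k
  simp [hne] at this

lemma coeff_expand_W_eq_sum (χ : CharX M r) :
    (A.X.expand A.W).coeff χ = ∑ k, (A.X.expand (A.Wpart k)).coeff χ := by
  rw [W, map_sum, AddMonoidAlgebra.coeff_sum, Finsupp.finsetSum_apply]

lemma coeff_expand_W {k : Fin r} {χ : CharX M r} (h : χ ∈ A.Lam k) :
    (A.X.expand A.W).coeff χ = (A.X.expand (A.Wpart k)).coeff χ := by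
  rw [coeff_expand_W_eq_sum]
  refine Finset.sum_eq_single k (fun k' _ hk => ?_) (by simp)
  by_contra hne
  exact hk (A.Lam_disjoint (Finsupp.mem_support_iff.mpr hne) h)

lemma exists_mem_Lam {χ : CharX M r} (h : (A.X.expand A.W).coeff χ ≠ 0) : ∃ k, χ ∈ A.Lam k := by
  rw [coeff_expand_W_eq_sum] at h
  obtain ⟨k, _, hk⟩ := Finset.exists_ne_zero_of_sum_ne_zero h
  exact ⟨k, Finsupp.mem_support_iff.mpr hk⟩

/-- The global characters of the total space. -/
def globalChar : AddSubmonoid (CharX M r) where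
  carrier := {χ | ∃ w, A.X.expand w = chi χ}
  zero_mem' := ⟨1, map_one _⟩
  add_mem' := by
    rintro χ χ' ⟨w, hw⟩ ⟨w', hw'⟩
    exact ⟨w * w', by rw [map_mul, hw, hw', AddMonoidAlgebra.single_mul_single, _root_.mul_one]⟩

lemma mem_globalChar_of_mem_Lam [Module.Free ℤ M] {k : Fin r} {χ : CharX M r}
    (h : χ ∈ A.Lam k) : χ ∈ A.globalChar :=
  A.X.exists_expand_eq_chi h

/-- The characters of the torus of `X` are generated by those of the torus of `Y` and any choice of
characters in the sets `Lam k`. -/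
lemma mem_of_forall_inl_mem (hne : ∀ k, (A.Lam k).Nonempty) (H : AddSubgroup (CharX M r))
    (h : ∀ m, (m, 0) ∈ H) (hL : ∀ k, ∀ χ ∈ A.Lam k, χ ∈ H) (χ : CharX M r) : χ ∈ H := by
  have hk (k : Fin r) : ((0, Pi.single k 1) : CharX M r) ∈ H := by
    obtain ⟨χ, hχ⟩ := hne k
    have h1 : ((0, Pi.single k 1) : CharX M r) = χ - (χ.1, 0) := by
      rw [← A.snd_eq_of_mem_Lam hχ]
      ext <;> simp
    rw [h1]
    exact H.sub_mem (hL k χ hχ) (h _)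
  have hx : χ = (χ.1, 0) + ∑ k, χ.2 k • ((0, Pi.single k 1) : CharX M r) := by
    ext
    · simp [Prod.fst_sum]
    · simp [Prod.snd_sum, Finset.sum_apply, Pi.single_apply]
  rw [hx]
  exact H.add_mem (h _) (H.sum_mem fun k _ => H.zsmul_mem (hk k) _)

lemma QuotientsGenerate.inl_mem {A : ToricCI M r} (hq : A.QuotientsGenerate)
    (H : AddSubgroup (CharX M r))
    (h : ∀ k, ∀ χ ∈ A.Lam k, ∀ χ' ∈ A.Lam k, χ - χ' ∈ H) (m : M) : (m, 0) ∈ H := by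
  have h1 : AddSubgroup.closure {m : M | ∃ k, ∃ χ ∈ A.Lam k, ∃ χ' ∈ A.Lam k, χ - χ' = (m, 0)} ≤
      H.comap (AddMonoidHom.inl M (Fin r → ℤ)) := by
    rw [AddSubgroup.closure_le]
    rintro m ⟨k, χ, hχ, χ', hχ', e⟩
    change (m, 0) ∈ H
    rw [← e]
    exact h k χ hχ χ' hχ'
  rw [hq] at h1
  exact h1 (AddSubgroup.mem_top m)

/-- Characters in `Lam k` are global. Their quotients give all characters from `Y`, and one of them
for each `k` then gives the fibre coordinates. -/
lemma closure_globalChar [Module.Free ℤ M] (hne : ∀ k, (A.Lam k).Nonempty)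
    (hq : A.QuotientsGenerate) : AddSubgroup.closure (A.globalChar : Set (CharX M r)) = ⊤ := by
  have hL (k) (χ) (hχ : χ ∈ A.Lam k) :
      χ ∈ AddSubgroup.closure (A.globalChar : Set (CharX M r)) :=
    AddSubgroup.subset_closure (A.mem_globalChar_of_mem_Lam hχ)
  exact top_le_iff.mp fun χ _ => A.mem_of_forall_inl_mem hne _
    (hq.inl_mem _ fun k χ hχ χ' hχ' => sub_mem (hL k χ hχ) (hL k χ' hχ')) hL χ

end Single

/-! ### The identification of the tori -/

section Pair

variable {M₁ M₂ : Type} [AddCommGroup M₁] [AddCommGroup M₂] {r : ℕ}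
  {A : ToricCI M₁ r} {B : ToricCI M₂ r} (Φ : AffinizationIso A B)

lemma chi_injective {M : Type} : Function.Injective (chi : M → AddMonoidAlgebra ℂ M) :=
  fun _ _ h => AddMonoidAlgebra.single_left_injective one_ne_zero h

/-- The pairs of global characters which are identified by `Φ`. -/
def globalPairs : AddSubmonoid (CharX M₁ r × CharX M₂ r) where
  carrier := {χ | ∃ w, A.X.expand w = chi χ.1 ∧ B.X.expand (Φ.iso w) = chi χ.2}
  zero_mem' := ⟨1, map_one _, by rw [map_one, map_one]; rfl⟩
  add_mem' := by
    rintro χ χ' ⟨w, hw, hv⟩ ⟨w', hw', hv'⟩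
    refine ⟨w * w', ?_, ?_⟩
    · rw [map_mul, hw, hw', AddMonoidAlgebra.single_mul_single, _root_.mul_one]; rfl
    · rw [map_mul, map_mul, hv, hv', AddMonoidAlgebra.single_mul_single, _root_.mul_one]; rfl

lemma exists_sub_of_mem_closure {N : Type*} [AddCommGroup N] (H : AddSubmonoid N) {x : N}
    (hx : x ∈ AddSubgroup.closure (H : Set N)) : ∃ y ∈ H, ∃ z ∈ H, x = y - z := by
  induction hx using AddSubgroup.closure_induction with
  | mem x hx => exact ⟨x, hx, 0, H.zero_mem, by simp⟩
  | zero => exact ⟨0, H.zero_mem, 0, H.zero_mem, by simp⟩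
  | add x x' _ _ h h' =>
    obtain ⟨y, hy, z, hz, rfl⟩ := h
    obtain ⟨y', hy', z', hz', rfl⟩ := h'
    exact ⟨y + y', H.add_mem hy hy', z + z', H.add_mem hz hz', by abel⟩
  | neg x _ h =>
    obtain ⟨y, hy, z, hz, rfl⟩ := h
    exact ⟨z, hz, y, hy, by abel⟩

/-- The group of pairs of characters generated by the pairs identified by `Φ`. -/
def charGraph : AddSubgroup (CharX M₁ r × CharX M₂ r) :=
  AddSubgroup.closure (globalPairs Φ : Set (CharX M₁ r × CharX M₂ r))

/-- Every element is a difference of two identified pairs. If the first components agree, both pairs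
come from the same function, so the second components agree too. -/
lemma charGraph_fst_bijective (hA : AddSubgroup.closure (A.globalChar : Set (CharX M₁ r)) = ⊤) :
    Function.Bijective ((AddMonoidHom.fst _ _).comp (charGraph Φ).subtype) := by
  constructor
  · rw [injective_iff_map_eq_zero]
    rintro ⟨x, hx⟩ h
    obtain ⟨y, ⟨w, hw, hv⟩, z, ⟨w', hw', hv'⟩, rfl⟩ := exists_sub_of_mem_closure _ hx
    have h1 : y.1 = z.1 := sub_eq_zero.mp h
    have h2 : w = w' := A.X.expand_injective (by rw [hw, hw', h1])
    subst h2
    have h3 : y.2 = z.2 := chi_injective (hv.symm.trans hv')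
    ext1
    exact sub_eq_zero.mpr (Prod.ext h1 h3)
  · rw [← AddMonoidHom.range_eq_top, ← top_le_iff, ← hA, AddSubgroup.closure_le]
    rintro χ ⟨w, hw⟩
    obtain ⟨χ', hχ'⟩ := (Φ.iso_character w).mpr ⟨χ, hw⟩
    exact ⟨⟨(χ, χ'), AddSubgroup.subset_closure ⟨w, hw, hχ'⟩⟩, rfl⟩

lemma charGraph_snd_bijective (hB : AddSubgroup.closure (B.globalChar : Set (CharX M₂ r)) = ⊤) :
    Function.Bijective ((AddMonoidHom.snd _ _).comp (charGraph Φ).subtype) := by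
  constructor
  · rw [injective_iff_map_eq_zero]
    rintro ⟨x, hx⟩ h
    obtain ⟨y, ⟨w, hw, hv⟩, z, ⟨w', hw', hv'⟩, rfl⟩ := exists_sub_of_mem_closure _ hx
    have h1 : y.2 = z.2 := sub_eq_zero.mp h
    have h2 : w = w' := Φ.iso.injective (B.X.expand_injective (by rw [hv, hv', h1]))
    subst h2
    have h3 : y.1 = z.1 := chi_injective (hw.symm.trans hw')
    ext1
    exact sub_eq_zero.mpr (Prod.ext h3 h1)
  · rw [← AddMonoidHom.range_eq_top, ← top_le_iff, ← hB, AddSubgroup.closure_le]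
    rintro χ ⟨w, hw⟩
    obtain ⟨χ', hχ'⟩ := (Φ.iso_character (Φ.iso.symm w)).mp
      (by rw [RingEquiv.apply_symm_apply]; exact ⟨χ, hw⟩)
    exact ⟨⟨(χ', χ), AddSubgroup.subset_closure
      ⟨_, hχ', by rw [RingEquiv.apply_symm_apply]; exact hw⟩⟩, rfl⟩

/-- Each global function is a finite linear combination of global characters, so agreement on
characters is enough. -/
lemma compatible_of_forall_chi [Module.Free ℤ M₁] (θ : CharX M₁ r ≃+ CharX M₂ r)
    (h : ∀ w χ, A.X.expand w = chi χ → B.X.expand (Φ.iso w) = chi (θ χ)) : Compatible Φ θ := by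
  intro w
  have h1 (χ : CharX M₁ r) (hχ : χ ∈ (A.X.expand w).coeff.support) :=
    A.X.exists_expand_eq_chi hχ
  choose v hv using h1
  have hw : w = ∑ χ : (A.X.expand w).coeff.support,
      constants A.X.V ((A.X.expand w).coeff χ) * v χ χ.2 := by
    apply A.X.expand_injective
    rw [map_sum]
    simp only [map_mul, hv, ToricVariety.expand_constants]
    conv_lhs => rw [← AddMonoidAlgebra.sum_coeff_single (A.X.expand w)]
    rw [Finsupp.sum, ← Finset.sum_coe_sort]
    refine Finset.sum_congr rfl fun χ _ => ?_
    simp [AddMonoidAlgebra.single_mul_single]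
  have h2 (f g : Γ(A.X.V.left, ⊤) →+* AddMonoidAlgebra ℂ (CharX M₂ r))
      (hc : ∀ c, f (constants A.X.V c) = g (constants A.X.V c))
      (hfg : ∀ χ hχ, f (v χ hχ) = g (v χ hχ)) : f w = g w := by
    rw [hw, map_sum, map_sum]
    refine Finset.sum_congr rfl fun χ _ => ?_
    rw [map_mul, map_mul, hc, hfg]
  refine h2 (B.X.expand.comp Φ.iso.toRingHom) ((AddMonoidAlgebra.mapDomainRingHom ℂ
    (θ : CharX M₁ r →+ CharX M₂ r)).comp A.X.expand) (fun c => ?_) (fun χ hχ => ?_)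
  · simp only [RingHom.comp_apply]
    have : Φ.iso.toRingHom (constants A.X.V c) = constants B.X.V c := Φ.iso_constants c
    rw [this, ToricVariety.expand_constants, ToricVariety.expand_constants]
    simp
  · simp only [RingHom.comp_apply]
    rw [hv]
    refine (h _ χ (hv χ hχ)).trans ?_
    simp

lemma Compatible.expand_eq_chi {Φ : AffinizationIso A B} {θ : CharX M₁ r ≃+ CharX M₂ r}
    (h : Compatible Φ θ) {w} {χ} (hw : A.X.expand w = chi χ) :
    B.X.expand (Φ.iso w) = chi (θ χ) := by
  rw [h, hw]
  simp

/-- The group generated by the identified pairs is the graph of an isomorphism. Uniqueness holds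
because global characters generate. -/
theorem existsUnique_compatible [Module.Free ℤ M₁]
    (hA : AddSubgroup.closure (A.globalChar : Set (CharX M₁ r)) = ⊤)
    (hB : AddSubgroup.closure (B.globalChar : Set (CharX M₂ r)) = ⊤) :
    ∃! θ : CharX M₁ r ≃+ CharX M₂ r, Compatible Φ θ := by
  let e₁ := AddEquiv.ofBijective _ (charGraph_fst_bijective Φ hA)
  let e₂ := AddEquiv.ofBijective _ (charGraph_snd_bijective Φ hB)
  refine ⟨e₁.symm.trans e₂, compatible_of_forall_chi Φ _ fun w χ hw => ?_, fun θ hθ => ?_⟩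
  · obtain ⟨χ', hχ'⟩ := (Φ.iso_character w).mpr ⟨χ, hw⟩
    have h1 : e₁ ⟨(χ, χ'), AddSubgroup.subset_closure ⟨w, hw, hχ'⟩⟩ = χ := rfl
    have h2 : (e₁.symm.trans e₂) χ = χ' := by
      conv_lhs => rw [← h1]
      rw [AddEquiv.trans_apply, AddEquiv.symm_apply_apply]
      rfl
    rw [h2, hχ']
  · have h : (θ : CharX M₁ r →+ CharX M₂ r) =
        ((e₁.symm.trans e₂ : CharX M₁ r ≃+ CharX M₂ r) : CharX M₁ r →+ CharX M₂ r) := by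
      refine AddMonoidHom.eq_of_eqOn_dense hA ?_
      rintro χ ⟨w, hw⟩
      have h1 := hθ.expand_eq_chi hw
      have h2 : e₁ ⟨(χ, θ χ), AddSubgroup.subset_closure ⟨w, hw, h1⟩⟩ = χ := rfl
      change θ χ = e₂ (e₁.symm χ)
      conv_rhs => rw [← h2]
      rw [AddEquiv.symm_apply_apply]
      rfl
    exact AddEquiv.ext fun x => DFunLike.congr_fun h x

end Pair

end ToricCI

namespace ToricCI

namespace Presentation

section

variable {M : Type} [AddCommGroup M] {r : ℕ} {C : ToricCI M r} {N β : Type} [AddCommGroup N]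
  (P : Presentation C N β) {S : Over SpecC}

lemma idealZ_le_ker_iff (f : S ⟶ Torus N) :
    C.idealZ ≤ (f ≫ P.proj).left.ker ↔ ∀ a, ∑ b, pullT f (P.W a b) = 0 := by
  rw [proj, ← Category.assoc, ToricCI.idealZ_le_ker_iff, ← P.τ.forall_congr_right]
  refine forall_congr' fun a => ?_
  rw [sum_row_pullT_W, (isUnit_pullT_chi f (P.u a)).mul_right_eq_zero]

/-- The criterion over the residue field, with the rooted determinant of `(W)` replaced by the
associated function `d` from `Y`. -/
lemma rank_add_card_eq_iff [Fintype β] (t : PrimeSpectrum (AddMonoidAlgebra ℂ N))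
    (hrow : ∀ a, ∑ b, P.W a b ∈ t.asIdeal) (hcol : ∀ b, ∑ a, P.W a b ∈ t.asIdeal) :
    (P.W.map (algebraMap _ t.asIdeal.ResidueField)).rank + Fintype.card β = r ↔
      AddMonoidAlgebra.mapDomainRingHom ℂ P.incl P.d ∉ t.asIdeal := by
  rw [ToricLG.rank_add_card_eq_iff P.c P.ρ P.c_ρ _ (fun a b h => ?_) (fun a => ?_) (fun b => ?_),
    ← rootedMatrix_map, ← RingHom.mapMatrix_apply, ← RingHom.map_det, ne_eq,
    Ideal.algebraMap_residueField_eq_zero]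
  · have h := associated_det_rootedMatrix P.c P.ρ (fun a => chi (P.u a))
      (fun a => ⟨⟨chi (P.u a), chi (-P.u a), by
        rw [AddMonoidAlgebra.single_mul_single, add_neg_cancel, _root_.mul_one]; rfl, by
        rw [AddMonoidAlgebra.single_mul_single, neg_add_cancel, _root_.mul_one]; rfl⟩, rfl⟩)
      (P.F.map (AddMonoidAlgebra.mapDomainRingHom ℂ P.incl))
    have hd : (rootedMatrix P.c P.ρ
        (P.F.map (AddMonoidAlgebra.mapDomainRingHom ℂ P.incl))).det =
        AddMonoidAlgebra.mapDomainRingHom ℂ P.incl P.d := by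
      rw [← rootedMatrix_map, d, RingHom.map_det, RingHom.mapMatrix_apply]
    rw [hd] at h
    exact not_congr ⟨fun h' => t.asIdeal.mem_of_dvd h.dvd h',
      fun h' => t.asIdeal.mem_of_dvd h.symm.dvd h'⟩
  · rw [Matrix.map_apply, W, Matrix.of_apply, P.F_block a b h, map_zero, mul_zero, map_zero]
  · simp only [Matrix.map_apply]
    rw [← map_sum, Ideal.algebraMap_residueField_eq_zero]
    exact hrow a
  · simp only [Matrix.map_apply]
    rw [← map_sum, Ideal.algebraMap_residueField_eq_zero]
    exact hcol b

/-- The locus on which the determinant of the rooted matrix does not vanish. -/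
def rankLocus (I : (Torus N).left.IdealSheafData) : I.subscheme.Opens :=
  I.subschemeι ⁻¹ᵁ (show (Torus N).left.Opens from PrimeSpectrum.basicOpen
    (R := AddMonoidAlgebra ℂ N) (AddMonoidAlgebra.mapDomainRingHom ℂ P.incl P.d))

lemma mem_rankLocus_iff (I : (Torus N).left.IdealSheafData) (x : I.subscheme) :
    x ∈ P.rankLocus I ↔ AddMonoidAlgebra.mapDomainRingHom ℂ P.incl P.d ∉
      PrimeSpectrum.asIdeal (I.subschemeι x) :=
  Iff.rfl

lemma mem_asIdeal_subschemeι {I : (Torus N).left.IdealSheafData} (w : AddMonoidAlgebra ℂ N)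
    (h : ∀ {S : Over SpecC} (f : S ⟶ Torus N), I ≤ f.left.ker → pullT f w = 0)
    (x : I.subscheme) : w ∈ PrimeSpectrum.asIdeal (I.subschemeι x) := by
  let f : Over.mk (I.subschemeι ≫ (Torus N).hom) ⟶ Torus N := Over.homMk I.subschemeι
  exact mem_asIdeal_of_eq_zero (R := .of (AddMonoidAlgebra ℂ N)) f.left
    (h f (Scheme.IdealSheafData.ker_subschemeι I).ge) x

/-- The presentation of the torus given by a matrix `(W)`. -/
def ofMatrix (C : ToricCI M r) (iso : CharX M r ≃+ N) (τ : Equiv.Perm (Fin r)) (c : Fin r → β)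
    (ρ : β → Fin r) (c_ρ : ∀ j, c (ρ j) = j) (ω : N →+ (β → ℤ)) (ω_inl : ∀ m, ω (iso (m, 0)) = 0)
    (ω_single : by classical exact ∀ k, ω (iso (0, Pi.single (τ k) 1)) = Pi.single (c k) 1)
    (W : Matrix (Fin r) (Fin r) (AddMonoidAlgebra ℂ N)) (block : ∀ a b, c a ≠ c b → W a b = 0)
    (row : ∀ a, AddMonoidAlgebra.mapDomainRingHom ℂ (iso.symm : N →+ CharX M r) (∑ b, W a b) =
      C.X.expand (C.Wpart (τ a))) : Presentation C N β where
  iso := iso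
  τ := τ
  c := c
  ρ := ρ
  c_ρ := c_ρ
  ω := ω
  ω_inl := ω_inl
  ω_single := ω_single
  F := W.map (AddMonoidAlgebra.mapDomainRingHom ℂ
    ((AddMonoidHom.fst M (Fin r → ℤ)).comp (iso.symm : N →+ CharX M r)))
  F_block a b h := by rw [Matrix.map_apply, block a b h, map_zero]
  F_row a := by
    simp only [Matrix.map_apply]
    rw [← map_sum, coord_eq_mapDomain, ← row, AddMonoidAlgebra.mapDomainRingHom_comp]
    rfl

/-- `F` forgets the fibre part of each character. In row `a` that part is always `u_a`, so
multiplication by `u_a` restores it. -/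
lemma ofMatrix_W (iso : CharX M r ≃+ N) (τ c ρ c_ρ ω ω_inl ω_single W block row)
    (hW : ∀ a b, ∀ n ∈ (W a b).coeff.support, (iso.symm n).2 = Pi.single (τ a) 1) :
    (ofMatrix (β := β) C iso τ c ρ c_ρ ω ω_inl ω_single W block row).W = W := by
  ext1 a b
  change chi (iso (0, Pi.single (τ a) 1)) * AddMonoidAlgebra.mapDomainRingHom ℂ
    ((iso : CharX M r →+ N).comp (AddMonoidHom.inl M (Fin r → ℤ)))
      (AddMonoidAlgebra.mapDomainRingHom ℂ
        ((AddMonoidHom.fst M (Fin r → ℤ)).comp (iso.symm : N →+ CharX M r)) (W a b)) = W a b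
  conv_rhs => rw [← AddMonoidAlgebra.sum_coeff_single (W a b)]
  conv_lhs => rw [← AddMonoidAlgebra.sum_coeff_single (W a b)]
  rw [Finsupp.sum, map_sum, map_sum, Finset.mul_sum]
  refine Finset.sum_congr rfl fun n hn => ?_
  have h1 : iso (0, Pi.single (τ a) 1) + iso ((iso.symm n).1, 0) = n := by
    rw [← map_add, ← hW a b n hn]
    simp
  simp [AddMonoidAlgebra.single_mul_single, h1]

end

end Presentation

/-! ### The two presentations of the torus -/

section Pair

variable {M₁ M₂ : Type} [AddCommGroup M₁] [AddCommGroup M₂] {r : ℕ}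
  {A : ToricCI M₁ r} {B : ToricCI M₂ r} {Φ : AffinizationIso A B}
  {θ : CharX M₁ r ≃+ CharX M₂ r} {σ : Equiv.Perm (Fin r)}

lemma Compatible.mem_commonLam_iff [Module.Free ℤ M₁] (hθ : Compatible Φ θ) {a b : Fin r}
    {χ : CharX M₁ r} : χ ∈ commonLam Φ a b ↔ χ ∈ A.Lam a ∧ θ χ ∈ B.Lam b := by
  classical
  rw [commonLam, Finset.mem_filter]
  refine and_congr_right fun h => ⟨?_, fun h' => ?_⟩
  · rintro ⟨w, hw, χ', hχ', hv⟩
    rwa [chi_injective ((hθ.expand_eq_chi hw).symm.trans hv)]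
  · obtain ⟨w, hw⟩ := A.mem_globalChar_of_mem_Lam h
    exact ⟨w, hw, _, h', hθ.expand_eq_chi hw⟩

lemma Compatible.coeff_expand_W (hθ : Compatible Φ θ) (χ : CharX M₁ r) :
    (B.X.expand B.W).coeff (θ χ) = (A.X.expand A.W).coeff χ := by
  rw [← Φ.iso_W, hθ]
  exact Finsupp.mapDomain_apply θ.injective _ _

lemma coeff_expand_W_ne_zero {M : Type} [AddCommGroup M] {A : ToricCI M r} {k : Fin r}
    {χ : CharX M r} (h : χ ∈ A.Lam k) : (A.X.expand A.W).coeff χ ≠ 0 := by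
  rw [A.coeff_expand_W h]
  exact Finsupp.mem_support_iff.mp h

lemma Compatible.exists_mem_Lam₂ (hθ : Compatible Φ θ) {a : Fin r} {χ : CharX M₁ r}
    (h : χ ∈ A.Lam a) : ∃ b, θ χ ∈ B.Lam (σ b) := by
  obtain ⟨k, hk⟩ := B.exists_mem_Lam (by rw [hθ.coeff_expand_W]; exact coeff_expand_W_ne_zero h)
  exact ⟨σ.symm k, by rwa [σ.apply_symm_apply]⟩

lemma Compatible.exists_mem_Lam₁ (hθ : Compatible Φ θ) {b : Fin r} {χ : CharX M₁ r}
    (h : θ χ ∈ B.Lam b) : ∃ a, χ ∈ A.Lam a :=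
  A.exists_mem_Lam (by rw [← hθ.coeff_expand_W]; exact coeff_expand_W_ne_zero h)

open scoped Classical in
lemma coeff_matrixW (a b : Fin r) (χ : CharX M₁ r) : (matrixW Φ σ a b).coeff χ =
    if χ ∈ commonLam Φ a (σ b) then (A.X.expand A.W).coeff χ else 0 := by
  rw [matrixW, Matrix.of_apply, AddMonoidAlgebra.coeff_sum, Finsupp.finsetSum_apply]
  simp [Finsupp.single_apply]

lemma mem_commonLam_of_coeff_ne_zero {a b : Fin r} {χ : CharX M₁ r}
    (h : χ ∈ (matrixW Φ σ a b).coeff.support) : χ ∈ commonLam Φ a (σ b) := by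
  classical
  rw [Finsupp.mem_support_iff, coeff_matrixW] at h
  by_contra hn
  exact h (if_neg hn)

/-- Each character of `Λ⁽¹⁾_a` lies in exactly one `Λ⁽²⁾_b`, so the row distributes the terms of
`W⁽¹⁾_a` without loss or repetition. -/
lemma Compatible.sum_row_matrixW [Module.Free ℤ M₁] (hθ : Compatible Φ θ) (a : Fin r) :
    ∑ b, matrixW Φ σ a b = A.X.expand (A.Wpart a) := by
  classical
  ext χ
  rw [AddMonoidAlgebra.coeff_sum, Finsupp.finsetSum_apply]
  simp only [coeff_matrixW, hθ.mem_commonLam_iff]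
  by_cases h : χ ∈ A.Lam a
  · obtain ⟨b, hb⟩ := hθ.exists_mem_Lam₂ (σ := σ) h
    rw [Finset.sum_eq_single b, if_pos ⟨h, hb⟩, A.coeff_expand_W h]
    · exact fun b' _ hne => if_neg fun h' => hne (σ.injective (B.Lam_disjoint h'.2 hb))
    · simp
  · rw [Finset.sum_eq_zero fun b _ => if_neg fun h' => h h'.1]
    exact (Finsupp.notMem_support_iff.mp h).symm

lemma Compatible.sum_col_matrixW [Module.Free ℤ M₁] (hθ : Compatible Φ θ) (b : Fin r) :
    AddMonoidAlgebra.mapDomainRingHom ℂ (θ : CharX M₁ r →+ CharX M₂ r)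
      (∑ a, matrixW Φ σ a b) = B.X.expand (B.Wpart (σ b)) := by
  classical
  ext χ
  obtain ⟨χ, rfl⟩ := θ.surjective χ
  refine (Finsupp.mapDomain_apply θ.injective _ χ).trans ?_
  rw [AddMonoidAlgebra.coeff_sum, Finsupp.finsetSum_apply]
  simp only [coeff_matrixW, hθ.mem_commonLam_iff]
  by_cases h : θ χ ∈ B.Lam (σ b)
  · obtain ⟨a, ha⟩ := hθ.exists_mem_Lam₁ h
    rw [Finset.sum_eq_single a, if_pos ⟨ha, h⟩, ← B.coeff_expand_W h, hθ.coeff_expand_W]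
    · exact fun a' _ hne => if_neg fun h' => hne (A.Lam_disjoint h'.1 ha)
    · simp
  · rw [Finset.sum_eq_zero fun b _ => if_neg fun h' => h h'.2]
    exact (Finsupp.notMem_support_iff.mp h).symm

lemma connectedComponentMk_eq {a b : Fin r} (h : (commonLam Φ a (σ b)).Nonempty) :
    (graphD Φ σ).connectedComponentMk a = (graphD Φ σ).connectedComponentMk b := by
  by_cases hab : a = b
  · rw [hab]
  · exact SimpleGraph.ConnectedComponent.sound
      (SimpleGraph.Adj.reachable (by rw [graphD, SimpleGraph.fromRel_adj]; exact ⟨hab, .inl h⟩))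

lemma matrixW_eq_zero {a b : Fin r} (h : (graphD Φ σ).connectedComponentMk a ≠
    (graphD Φ σ).connectedComponentMk b) : matrixW Φ σ a b = 0 := by
  rw [matrixW, Matrix.of_apply, Finset.not_nonempty_iff_eq_empty.mp
    (fun h' => h (connectedComponentMk_eq h')), Finset.sum_empty]

lemma blockWeight_inl (m : M₁) : blockWeight Φ σ (m, 0) = 0 := by
  simp [blockWeight]

open scoped Classical in
lemma blockWeight_of_snd_eq {χ : CharX M₁ r} {a : Fin r} (h : χ.2 = Pi.single a 1) :
    blockWeight Φ σ χ = Pi.single ((graphD Φ σ).connectedComponentMk a) 1 := by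
  change ∑ a', (Pi.single ((graphD Φ σ).connectedComponentMk a') (χ.2 a') : Blocks Φ σ → ℤ) = _
  rw [h, Finset.sum_eq_single a] <;> simp +contextual

open scoped Classical in
-- Such a character also lies in some `Λ⁽¹⁾_a`; this gives an arrow from `a` to `b`, so both indices
-- are in the same component.
lemma Compatible.blockWeight_of_mem_Lam₂ [Module.Free ℤ M₁] (hθ : Compatible Φ θ) {b : Fin r}
    {χ : CharX M₂ r} (h : χ ∈ B.Lam (σ b)) :
    blockWeight Φ σ (θ.symm χ) = Pi.single ((graphD Φ σ).connectedComponentMk b) 1 := by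
  have h' : θ (θ.symm χ) ∈ B.Lam (σ b) := by rwa [θ.apply_symm_apply]
  obtain ⟨a, ha⟩ := hθ.exists_mem_Lam₁ h'
  rw [blockWeight_of_snd_eq (A.snd_eq_of_mem_Lam ha),
    connectedComponentMk_eq ⟨_, hθ.mem_commonLam_iff.mpr ⟨ha, h'⟩⟩]

/-- The action, defined through `X⁽¹⁾`, also fixes the coordinates of `Y⁽²⁾`: the characters in one
`Λ⁽²⁾_k` have equal weight, and their quotients generate. -/
lemma Compatible.blockWeight_symm_inl [Module.Free ℤ M₁] (hθ : Compatible Φ θ)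
    (hB : B.QuotientsGenerate) (m : M₂) : blockWeight Φ σ (θ.symm (m, 0)) = 0 := by
  refine hB.inl_mem ((blockWeight Φ σ).comp (θ.symm : CharX M₂ r →+ CharX M₁ r)).ker
    (fun k χ hχ χ' hχ' => ?_) m
  obtain ⟨b, rfl⟩ := σ.surjective k
  rw [AddMonoidHom.mem_ker, map_sub, sub_eq_zero]
  exact (hθ.blockWeight_of_mem_Lam₂ hχ).trans (hθ.blockWeight_of_mem_Lam₂ hχ').symm

open scoped Classical in
lemma Compatible.blockWeight_symm_single [Module.Free ℤ M₁] (hθ : Compatible Φ θ)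
    (hB : B.QuotientsGenerate) {b : Fin r} (hne : (B.Lam (σ b)).Nonempty) :
    blockWeight Φ σ (θ.symm (0, Pi.single (σ b) 1)) =
      Pi.single ((graphD Φ σ).connectedComponentMk b) 1 := by
  obtain ⟨χ, hχ⟩ := hne
  have h1 : ((0, Pi.single (σ b) 1) : CharX M₂ r) = χ - (χ.1, 0) := by
    rw [← B.snd_eq_of_mem_Lam hχ]
    ext <;> simp
  rw [h1, map_sub, map_sub, hθ.blockWeight_symm_inl hB, sub_zero, hθ.blockWeight_of_mem_Lam₂ hχ]

/-- The presentation of the torus by the first complete intersection. -/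
def Compatible.presentation₁ [Module.Free ℤ M₁] (hθ : Compatible Φ θ)
    (σ : Equiv.Perm (Fin r)) : Presentation A (CharX M₁ r) (Blocks Φ σ) :=
  .ofMatrix A (.refl _) 1 (graphD Φ σ).connectedComponentMk Quot.out Quot.out_eq
    (blockWeight Φ σ) blockWeight_inl (fun k => blockWeight_of_snd_eq rfl) (matrixW Φ σ)
    (fun _ _ h => matrixW_eq_zero h)
    (fun a => by
      rw [hθ.sum_row_matrixW]
      exact congr($(AddMonoidAlgebra.mapDomainRingHom_id) _))

/-- The presentation of the torus by the second complete intersection. -/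
def Compatible.presentation₂ [Module.Free ℤ M₁] (hθ : Compatible Φ θ) (hB : B.QuotientsGenerate)
    (hne : ∀ k, (B.Lam (σ k)).Nonempty) : Presentation B (CharX M₁ r) (Blocks Φ σ) :=
  .ofMatrix B θ.symm σ (graphD Φ σ).connectedComponentMk Quot.out Quot.out_eq
    (blockWeight Φ σ) (hθ.blockWeight_symm_inl hB)
    (fun k => hθ.blockWeight_symm_single hB (hne k)) (matrixW Φ σ).transpose
    (fun a b h => by rw [Matrix.transpose_apply, matrixW_eq_zero h.symm])
    (fun a => by
      rw [← hθ.sum_col_matrixW a]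
      rfl)

lemma Compatible.presentation₁_W [Module.Free ℤ M₁] (hθ : Compatible Φ θ) :
    (hθ.presentation₁ σ).W = matrixW Φ σ :=
  Presentation.ofMatrix_W _ _ _ _ _ _ _ _ _ _ _ fun _ _ _ h =>
    A.snd_eq_of_mem_Lam (hθ.mem_commonLam_iff.mp (mem_commonLam_of_coeff_ne_zero h)).1

lemma Compatible.presentation₂_W [Module.Free ℤ M₁] (hθ : Compatible Φ θ)
    (hB : B.QuotientsGenerate) (hne : ∀ k, (B.Lam (σ k)).Nonempty) :
    (hθ.presentation₂ hB hne).W = (matrixW Φ σ).transpose := by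
  refine Presentation.ofMatrix_W _ _ _ _ _ _ _ _ _ _ _ fun a b χ h => ?_
  rw [Matrix.transpose_apply] at h
  rw [AddEquiv.symm_symm]
  exact B.snd_eq_of_mem_Lam (hθ.mem_commonLam_iff.mp (mem_commonLam_of_coeff_ne_zero h)).2

lemma Compatible.presentation₁_proj [Module.Free ℤ M₁] (hθ : Compatible Φ θ) :
    (hθ.presentation₁ σ).proj = proj₁ A :=
  A.emb_p.symm

lemma Compatible.presentation₂_proj [Module.Free ℤ M₁] (hθ : Compatible Φ θ)
    (hB : B.QuotientsGenerate) (hne : ∀ k, (B.Lam (σ k)).Nonempty) :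
    (hθ.presentation₂ hB hne).proj = proj₂ B θ := by
  rw [proj₂, B.emb_p, ← Category.assoc, torusHom_comp]
  rfl

end Pair

end ToricCI

/-! ### The common rank locus and its action -/

namespace ToricCI

lemma Presentation.IsRankLocus.exists_action {M N β : Type} [AddCommGroup M] [AddCommGroup N]
    {r : ℕ} {C : ToricCI M r} {P : Presentation C N β} {I : (Torus N).left.IdealSheafData}
    {R : I.subscheme.Opens} (hR : P.IsRankLocus I R) :
    ∃ act : ModObj (Torus (β → ℤ)) (subObj I R), act.smul ≫ subIncl I R =
      (torusHom P.ω ⊗ₘ subIncl I R) ≫ μ[Torus N] := by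
  have h := hR.exists_lift_mul (fst (Torus (β → ℤ)) (subObj I R))
    (snd (Torus (β → ℤ)) (subObj I R) ≫ subIncl I R) (hR.coord_eq_zero _) (hR.sum_col _)
    (hR.isUnit_d _)
  obtain ⟨a, ha⟩ := h
  have h1 : lift (fst (Torus (β → ℤ)) (subObj I R) ≫ torusHom P.ω)
      (snd (Torus (β → ℤ)) (subObj I R) ≫ subIncl I R) = torusHom P.ω ⊗ₘ subIncl I R := by
    ext1 <;> simp
  rw [h1] at ha
  exact ⟨modObjOfMono (torusHom P.ω) (torusHom_one _) (torusHom_mul _) (subIncl I R) a ha, ha⟩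

section Pair

variable {M₁ M₂ : Type} [AddCommGroup M₁] [AddCommGroup M₂] {r : ℕ}
  {A : ToricCI M₁ r} {B : ToricCI M₂ r} {Φ : AffinizationIso A B}
  {θ : CharX M₁ r ≃+ CharX M₂ r} {σ : Equiv.Perm (Fin r)}

lemma Compatible.idealS_le_ker_iff [Module.Free ℤ M₁] (hθ : Compatible Φ θ)
    (hB : B.QuotientsGenerate) (hne : ∀ k, (B.Lam (σ k)).Nonempty) {S : Over SpecC}
    (f : S ⟶ Torus (CharX M₁ r)) : idealS A B θ ≤ f.left.ker ↔
      (∀ a, ∑ b, pullT f (matrixW Φ σ a b) = 0) ∧ ∀ b, ∑ a, pullT f (matrixW Φ σ a b) = 0 := by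
  have h₁ := (hθ.presentation₁ σ).idealZ_le_ker_iff f
  have h₂ := (hθ.presentation₂ hB hne).idealZ_le_ker_iff f
  rw [hθ.presentation₁_W, hθ.presentation₁_proj] at h₁
  rw [hθ.presentation₂_W, hθ.presentation₂_proj] at h₂
  rw [ToricCI.idealS_le_ker_iff, h₁, h₂]
  rfl

section RankW

variable [Module.Free ℤ M₁] (hθ : Compatible Φ θ) (hB : B.QuotientsGenerate)
  (hne : ∀ k, (B.Lam (σ k)).Nonempty) (x : (idealS A B θ).subscheme)
include hθ hB hne

lemma Compatible.sum_row_mem (a : Fin r) : ∑ b, matrixW Φ σ a b ∈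
    PrimeSpectrum.asIdeal ((idealS A B θ).subschemeι x) :=
  Presentation.mem_asIdeal_subschemeι _ (fun f hf => by
    rw [map_sum]
    exact ((hθ.idealS_le_ker_iff hB hne f).mp hf).1 a) x

lemma Compatible.sum_col_mem (b : Fin r) : ∑ a, matrixW Φ σ a b ∈
    PrimeSpectrum.asIdeal ((idealS A B θ).subschemeι x) :=
  Presentation.mem_asIdeal_subschemeι _ (fun f hf => by
    rw [map_sum]
    exact ((hθ.idealS_le_ker_iff hB hne f).mp hf).2 b) x

lemma Compatible.mem_rankLocus₁_iff : x ∈ (hθ.presentation₁ σ).rankLocus (idealS A B θ) ↔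
    rankW Φ σ ((idealS A B θ).subschemeι x) + Nat.card (Blocks Φ σ) = r := by
  have := Fintype.ofFinite (Blocks Φ σ)
  have h := (hθ.presentation₁ σ).rank_add_card_eq_iff ((idealS A B θ).subschemeι x)
    (by rw [hθ.presentation₁_W]; exact hθ.sum_row_mem hB hne x)
    (by rw [hθ.presentation₁_W]; exact hθ.sum_col_mem hB hne x)
  rw [hθ.presentation₁_W] at h
  rw [Presentation.mem_rankLocus_iff, ← h, Nat.card_eq_fintype_card]
  rfl

lemma Compatible.mem_rankLocus₂_iff :
    x ∈ (hθ.presentation₂ hB hne).rankLocus (idealS A B θ) ↔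
      rankW Φ σ ((idealS A B θ).subschemeι x) + Nat.card (Blocks Φ σ) = r := by
  have := Fintype.ofFinite (Blocks Φ σ)
  have h := (hθ.presentation₂ hB hne).rank_add_card_eq_iff ((idealS A B θ).subschemeι x)
    (by rw [hθ.presentation₂_W]; exact hθ.sum_col_mem hB hne x)
    (by rw [hθ.presentation₂_W]; exact hθ.sum_row_mem hB hne x)
  rw [hθ.presentation₂_W] at h
  have h' : rankW Φ σ ((idealS A B θ).subschemeι x) = _ := (Matrix.rank_transpose _).symm
  rw [Presentation.mem_rankLocus_iff, ← h, Nat.card_eq_fintype_card, h']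
  rfl

lemma Compatible.isRankLocus₁ : (hθ.presentation₁ σ).IsRankLocus (idealS A B θ)
    ((hθ.presentation₁ σ).rankLocus (idealS A B θ)) where
  le_ker_iff f := by
    rw [hθ.presentation₁_W]
    exact hθ.idealS_le_ker_iff hB hne f
  mem_iff _ := Iff.rfl

/-- The open set defined by the first determinant serves both sides, since a matrix and its
transpose have the same rank on `S`. -/
lemma Compatible.isRankLocus₂ : (hθ.presentation₂ hB hne).IsRankLocus (idealS A B θ)
    ((hθ.presentation₁ σ).rankLocus (idealS A B θ)) where
  le_ker_iff f := by
    rw [hθ.presentation₂_W]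
    exact (hθ.idealS_le_ker_iff hB hne f).trans and_comm
  mem_iff x := by
    rw [hθ.mem_rankLocus₁_iff hB hne, ← hθ.mem_rankLocus₂_iff hB hne]
    rfl

end RankW

lemma exists_mem_Lam_of_mem_commonLam {a b : Fin r} (h : (commonLam Φ a b).Nonempty) :
    (A.Lam a).Nonempty ∧ (B.Lam b).Nonempty := by
  classical
  obtain ⟨χ, hχ⟩ := h
  obtain ⟨h1, w, -, χ', h2, -⟩ := Finset.mem_filter.mp hχ
  exact ⟨⟨χ, h1⟩, ⟨χ', h2⟩⟩

end Pair

end ToricCI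

end ToricLG

end

theorem mainTheorem2 {M₁ M₂ : Type} [AddCommGroup M₁] [AddCommGroup M₂]
    [Module.Free ℤ M₁] [Module.Finite ℤ M₁] [Module.Free ℤ M₂] [Module.Finite ℤ M₂] {r : ℕ}
    (A : ToricCI M₁ r) (B : ToricCI M₂ r) (Φ : AffinizationIso A B) (σ : Equiv.Perm (Fin r))
    (assumption1 : ∀ k, (commonLam Φ k (σ k)).Nonempty)
    (assumption2A : A.QuotientsGenerate) (assumption2B : B.QuotientsGenerate) :
    -- the tori of the two total spaces are canonically identified
    (∃! θ : CharX M₁ r ≃+ CharX M₂ r, Compatible Φ θ) ∧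
    ∀ θ : CharX M₁ r ≃+ CharX M₂ r, Compatible Φ θ →
      -- the rank locus `R = R⁽¹⁾ ∩ R⁽²⁾` and its images `Ω⁽¹⁾`, `Ω⁽²⁾` are open
      ∃ (R : (idealS A B θ).subscheme.Opens)
        (Ω₁ : A.idealZ.subscheme.Opens) (Ω₂ : B.idealZ.subscheme.Opens),
        (∀ x, x ∈ R ↔
          rankW Φ σ ((idealS A B θ).subschemeι x) + Nat.card (Blocks Φ σ) = r) ∧
        (∀ z, z ∈ Ω₁ ↔
          ∃ x ∈ R, (proj₁ A).left ((idealS A B θ).subschemeι x) = A.idealZ.subschemeι z) ∧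
        (∀ z, z ∈ Ω₂ ↔
          ∃ x ∈ R, (proj₂ B θ).left ((idealS A B θ).subschemeι x) = B.idealZ.subschemeι z) ∧
        -- projections, the action of `𝔾_m^β` by rescaling, and the isomorphism
        ∃ (π₁ : subObj (idealS A B θ) R ⟶ subObj A.idealZ Ω₁)
          (π₂ : subObj (idealS A B θ) R ⟶ subObj B.idealZ Ω₂)
          (act : ModObj (blockTorus Φ σ) (subObj (idealS A B θ) R))
          (ε : subObj A.idealZ Ω₁ ≅ subObj B.idealZ Ω₂),
          π₁ ≫ subIncl A.idealZ Ω₁ = subIncl (idealS A B θ) R ≫ proj₁ A ∧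
          π₂ ≫ subIncl B.idealZ Ω₂ = subIncl (idealS A B θ) R ≫ proj₂ B θ ∧
          act.smul ≫ subIncl (idealS A B θ) R =
            (torusHom (blockWeight Φ σ) ⊗ₘ subIncl (idealS A B θ) R) ≫
              μ[Torus (CharX M₁ r)] ∧
          IsTrivialTorsor (blockTorus Φ σ) π₁ ∧
          IsTrivialTorsor (blockTorus Φ σ) π₂ ∧
          π₁ ≫ ε.hom = π₂ := by
  have hA k := (exists_mem_Lam_of_mem_commonLam (assumption1 k)).1
  have hB k := (exists_mem_Lam_of_mem_commonLam (assumption1 k)).2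
  refine ⟨existsUnique_compatible Φ (A.closure_globalChar hA assumption2A)
    (B.closure_globalChar (fun k => by
      obtain ⟨k, rfl⟩ := σ.surjective k
      exact hB k) assumption2B), fun θ hθ => ?_⟩
  have := Fintype.ofFinite (Blocks Φ σ)
  have hR₁ := hθ.isRankLocus₁ assumption2B hB
  have hR₂ := hθ.isRankLocus₂ assumption2B hB
  obtain ⟨act, hact⟩ := hR₁.exists_action
  -- The torsor theorem is applied twice to the same scheme with the same action, once for each
  -- presentation.
  obtain ⟨hΩ₁, π₁, hπ₁, ht₁⟩ := hR₁.exists_isTrivialTorsor hact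
  obtain ⟨hΩ₂, π₂, hπ₂, ht₂⟩ := hR₂.exists_isTrivialTorsor hact
  obtain ⟨ε, hε⟩ := ht₁.exists_iso ht₂
  rw [hθ.presentation₁_proj] at hΩ₁ hπ₁
  rw [hθ.presentation₂_proj] at hΩ₂ hπ₂
  exact ⟨_, _, _, hθ.mem_rankLocus₁_iff assumption2B hB, hΩ₁, hΩ₂, π₁, π₂, act, ε, hπ₁, hπ₂, hact,
    ht₁, ht₂, hε⟩
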